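/- Let $A,B$ be finite-dimensional complex Hilbert spaces, let $\mathfrak D(\cdot)$ denote the set of density operators, and let $\log$ be the logarithm to base $2$. For $\rho\in\mathfrak D(AB)$ with marginal $\rho^A={\rm Tr}_B\,\rho$, put $$D_{\max}(\rho\|\sigma)=\inf\{\log t:\ t>0,\ t\sigma\ge\rho\},\qquad I_{\max}(A:B)_\rho=\min_{\sigma\in\mathfrak D(B)}D_{\max}(\rho\|\rho^A\otimes\sigma),$$ $$I_{\max}^\varepsilon(A:B)_\rho=\min\Big\{I_{\max}(A:B)_{\rho'}:\ \rho'\in\mathfrak D(AB),\ \tfrac12\|\rho-\rho'\|_1\le\varepsilon\Big\},$$ $$H_\alpha(A)_\rho=\frac1{1-\alpha}\log{\rm Tr}\big[(\rho^A)^\alpha\big],\qquad \tilde H_\beta^{\uparrow}(A|B)_\rho=-\min_{\sigma\in\mathfrak D(B)}D_\beta\big(\rho\,\big\|\,I^A\otimes\sigma\big),$$ where, for $\beta>1$, $D_\beta$ is the sandwiched Rényi relative entropy: $D_\beta(\rho\|\sigma)=\frac1{\beta-1}\log{\rm Tr}\big(\sigma^{\frac{1-\beta}{2\beta}}\rho\,\sigma^{\frac{1-\beta}{2\beta}}\big)^\beta$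 if the support of $\rho$ is contained in the support of $\sigma$ (negative powers being taken on the support of $\sigma$), and $D_\beta(\rho\|\sigma)=\infty$ otherwise. Then for all $\varepsilon,\alpha\in(0,1)$, all $\beta>1$ and all $\rho\in\mathfrak D(AB)$, $$I_{\max}^\varepsilon(A:B)_\rho\ \le\ H_\alpha(A)_\rho-\tilde H_\beta^{\uparrow}(A|B)_\rho+f_{\alpha,\beta}(\varepsilon),\qquad f_{\alpha,\beta}(\varepsilon)=\Big(\frac2{\beta-1}+\frac1{1-\alpha}\Big)\log\frac1{c\,\varepsilon^2},\quad c=2-\sqrt3 .$$ -/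

import Mathlib

open scoped Kronecker ComplexOrder

noncomputable section

namespace QInfo

/-- `ρ` is a density matrix: positive semidefinite with trace one. -/
def IsDensity {n : Type*} [Fintype n] (ρ : Matrix n n ℂ) : Prop :=
  ρ.PosSemidef ∧ ρ.trace = 1

/-- The marginal `ρ^A = Tr_B ρ^{AB}`. -/
def marginalA {A B : Type*} [Fintype B] (ρ : Matrix (A × B) (A × B) ℂ) : Matrix A A ℂ :=
  fun i j => ∑ b, ρ (i, b) (j, b)

/-- The power `M ^ s` of a positive semidefinite matrix, through the spectral decomposition.
As `(0 : ℝ) ^ s = 0` for `s ≠ 0`, negative powers are taken on the support of `M`. -/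
def mpow {n : Type*} [Fintype n] [DecidableEq n] (M : Matrix n n ℂ) (s : ℝ) : Matrix n n ℂ :=
  cfc (fun x : ℝ => x ^ s) M

/-- The trace norm `‖X‖₁ = Tr √(X* X)`. -/
def traceNorm {n : Type*} [Fintype n] [DecidableEq n] (X : Matrix n n ℂ) : ℝ :=
  (cfc Real.sqrt (X.conjTranspose * X)).trace.re

/-- The ball of density matrices at trace distance at most `ε` from `ρ`. -/
def ball {n : Type*} [Fintype n] [DecidableEq n] (ε : ℝ) (ρ : Matrix n n ℂ) :
    Set (Matrix n n ℂ) :=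
  {ρ' | IsDensity ρ' ∧ (1 / 2) * traceNorm (ρ - ρ') ≤ ε}

/-- The max relative entropy `inf {log t : t σ ≥ ρ}` (`⊤` if there is no such `t`). -/
def Dmax {n : Type*} [Fintype n] (ρ σ : Matrix n n ℂ) : EReal :=
  ⨅ (t : ℝ) (_ : 0 < t ∧ (t • σ - ρ).PosSemidef), ((Real.logb 2 t : ℝ) : EReal)

/-- The max mutual information `I_max(A:B)_ρ = min_{σ ∈ D(B)} D_max(ρ^{AB} ‖ ρ^A ⊗ σ^B)`. -/
def Imax {A B : Type*} [Fintype A] [Fintype B] (ρ : Matrix (A × B) (A × B) ℂ) : EReal :=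
  ⨅ (σ : Matrix B B ℂ) (_ : IsDensity σ), Dmax ρ (marginalA ρ ⊗ₖ σ)

/-- The smoothed max mutual information `I_max^ε(A:B)_ρ`. -/
def smoothImax {A B : Type*} [Fintype A] [Fintype B] [DecidableEq A] [DecidableEq B]
    (ε : ℝ) (ρ : Matrix (A × B) (A × B) ℂ) : EReal :=
  ⨅ ρ' ∈ ball ε ρ, Imax ρ'

/-- The Rényi entropy `H_α(ρ) = (1 - α)⁻¹ log Tr ρ^α`, for `α ≠ 1`. -/
def renyiEntropy {n : Type*} [Fintype n] [DecidableEq n] (α : ℝ) (ρ : Matrix n n ℂ) : ℝ :=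
  1 / (1 - α) * Real.logb 2 (mpow ρ α).trace.re

/-- `ρ ≪ σ`: the support of `ρ` is contained in that of `σ` (the support of a
positive semidefinite matrix is its range). -/
def SuppLE {n : Type*} [Fintype n] (ρ σ : Matrix n n ℂ) : Prop :=
  LinearMap.range ρ.mulVecLin ≤ LinearMap.range σ.mulVecLin

/-- `Q_β(ρ‖σ) = Tr (σ^((1-β)/(2β)) ρ σ^((1-β)/(2β)))^β`. -/
def Q {n : Type*} [Fintype n] [DecidableEq n] (β : ℝ) (ρ σ : Matrix n n ℂ) : ℝ :=
  (mpow (mpow σ ((1 - β) / (2 * β)) * ρ * mpow σ ((1 - β) / (2 * β))) β).trace.re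

open Classical in
/-- The sandwiched Rényi relative entropy of order `β > 1`. -/
def sandwichedD {n : Type*} [Fintype n] [DecidableEq n] (β : ℝ) (ρ σ : Matrix n n ℂ) : EReal :=
  if SuppLE ρ σ then ((1 / (β - 1) * Real.logb 2 (Q β ρ σ) : ℝ) : EReal) else ⊤

/-- The optimized sandwiched conditional Rényi entropy of order `β > 1`,
`H̃_β^↑(A|B)_ρ = - min_{σ ∈ D(B)} D_β(ρ^{AB} ‖ I^A ⊗ σ^B)`. -/
def condEntropyUp {A B : Type*} [Fintype A] [Fintype B] [DecidableEq A] [DecidableEq B]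
    (β : ℝ) (ρ : Matrix (A × B) (A × B) ℂ) : EReal :=
  -⨅ (σ : Matrix B B ℂ) (_ : IsDensity σ), sandwichedD β ρ ((1 : Matrix A A ℂ) ⊗ₖ σ)

/-- The correction term `f_{α,β}(ε) = (2/(β-1) + 1/(1-α)) log (1/(c ε²))`, `c = 2 - √3`. -/
def corr (α β ε : ℝ) : ℝ :=
  (2 / (β - 1) + 1 / (1 - α)) * Real.logb 2 (1 / ((2 - Real.sqrt 3) * ε ^ 2))

end QInfo

end

/-! Fix a density `σ` on `B` with `ρ ≪ 1 ⊗ σ`, put `τ = 1 ⊗ σ`, `q = Q β ρ τ`, `T = Tr (ρ^A)^α` and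
`x = c ε²`. It suffices to find a state within `ε` of `ρ` whose max mutual information is at most
`log (2 l / m)`, where `m^(1-α) T = 2x` and `x² l^(β-1) = q`: taking logarithms then gives the bound
for this `σ`, and the infimum over `σ` finishes the proof.

Let `P` project onto the eigenvalues of `ρ^A` that are at least `m`, and `p = P ⊗ 1`. The choice of
`m` makes the discarded mass at most `2x` (`trace_cutProj_mul_ge`). Data processing under projective
tests (`trace_proj_rpow_le`) and the choice of `l` show that the part of `p ρ p` exceeding `l P ⊗ σ`
has trace at most `x²`.

With `ρ = V Vᴴ`, `exists_smoothing` replaces `p V` by a Hilbert-Schmidt close `W` with `W Wᴴ ≤ l P ⊗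
σ`. It combines a Douglas factorization with the Powers-Størmer inequality. Smoothing may shrink the
marginal, so `exists_density_near` adds `X ⊗ σ`, where `X` is the positive part of the marginal
loss. The result `R` has marginal `R^A ≥ P ρ^A P ≥ m P`, as well as `R^A ≥ X`, whence `R ≤ l P ⊗ σ +
X ⊗ σ ≤ (l/m + 1) R^A ⊗ σ`. This survives normalization, and `m ≤ l` turns `l/m + 1` into `2 l/m`.
-/

set_option linter.unusedSectionVars false

noncomputable section

namespace QInfo

open Matrix

section matrices

variable {n : Type*} [Fintype n] [DecidableEq n]

/-! ### Functional calculus of Hermitian matrices -/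

/-- The spectral theorem, with the functional calculus in the same eigenbasis. -/
lemma exists_spectral {H : Matrix n n ℂ} (hH : H.IsHermitian) :
    ∃ (U : Matrix n n ℂ) (d : n → ℝ), Uᴴ * U = 1 ∧ U * Uᴴ = 1 ∧
      (∀ f : ℝ → ℝ, cfc f H = U * diagonal (fun i => (f (d i) : ℂ)) * Uᴴ) ∧
      (H = U * diagonal (fun i => (d i : ℂ)) * Uᴴ) ∧ (H.PosSemidef → ∀ i, 0 ≤ d i) := by
  refine ⟨hH.eigenvectorUnitary, hH.eigenvalues, ?_, ?_, ?_, ?_, ?_⟩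
  · exact Unitary.coe_star_mul_self hH.eigenvectorUnitary
  · exact Unitary.coe_mul_star_self hH.eigenvectorUnitary
  · intro f
    rw [hH.cfc_eq, Matrix.IsHermitian.cfc, Unitary.conjStarAlgAut_apply]
    rfl
  · conv_lhs => rw [hH.spectral_theorem, Unitary.conjStarAlgAut_apply]
    rfl
  · intro h i
    exact h.eigenvalues_nonneg i

lemma conj_diagonal_mul {U : Matrix n n ℂ} (hU : Uᴴ * U = 1) (f g : n → ℂ) :
    U * diagonal f * Uᴴ * (U * diagonal g * Uᴴ) = U * diagonal (fun i => f i * g i) * Uᴴ := by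
  rw [show U * diagonal f * Uᴴ * (U * diagonal g * Uᴴ)
    = U * (diagonal f * (Uᴴ * U) * diagonal g) * Uᴴ by simp only [Matrix.mul_assoc], hU]
  simp

lemma cfc_mul_cfc {H : Matrix n n ℂ} (hH : H.IsHermitian) (f g : ℝ → ℝ) :
    cfc f H * cfc g H = cfc (fun x => f x * g x) H := by
  obtain ⟨U, d, hU, -, hf, -, -⟩ := exists_spectral hH
  rw [hf, hf, hf, conj_diagonal_mul hU]
  simp

lemma cfc_mul_self_right {H : Matrix n n ℂ} (hH : H.IsHermitian) (f : ℝ → ℝ) :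
    cfc f H * H = cfc (fun x => f x * x) H := by
  obtain ⟨U, d, hU, -, hf, hd, -⟩ := exists_spectral hH
  rw [hf, hf]
  conv_lhs => rw [hd]
  rw [conj_diagonal_mul hU]
  simp

lemma cfc_mul_self_left {H : Matrix n n ℂ} (hH : H.IsHermitian) (f : ℝ → ℝ) :
    H * cfc f H = cfc (fun x => x * f x) H := by
  obtain ⟨U, d, hU, -, hf, hd, -⟩ := exists_spectral hH
  rw [hf, hf]
  conv_lhs => rw [hd]
  rw [conj_diagonal_mul hU]
  simp

lemma cfc_add_cfc {H : Matrix n n ℂ} (hH : H.IsHermitian) (f g : ℝ → ℝ) :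
    cfc f H + cfc g H = cfc (fun x => f x + g x) H := by
  obtain ⟨U, d, -, -, hf, -, -⟩ := exists_spectral hH
  rw [hf, hf, hf, ← add_mul, ← mul_add, diagonal_add]
  simp

lemma cfc_sub_cfc {H : Matrix n n ℂ} (hH : H.IsHermitian) (f g : ℝ → ℝ) :
    cfc f H - cfc g H = cfc (fun x => f x - g x) H := by
  obtain ⟨U, d, -, -, hf, -, -⟩ := exists_spectral hH
  rw [hf, hf, hf, ← sub_mul, ← mul_sub, diagonal_sub]
  simp

lemma cfc_real_smul {H : Matrix n n ℂ} (hH : H.IsHermitian) (r : ℝ) (f : ℝ → ℝ) :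
    r • cfc f H = cfc (fun x => r * f x) H := by
  obtain ⟨U, d, -, -, hf, -, -⟩ := exists_spectral hH
  rw [hf, hf, ← smul_mul_assoc, ← mul_smul_comm, ← diagonal_smul]
  congr
  ext i
  simp

lemma cfc_self {H : Matrix n n ℂ} (hH : H.IsHermitian) : cfc (fun x : ℝ => x) H = H :=
  cfc_id' ℝ H hH

lemma cfc_one_eq {H : Matrix n n ℂ} (hH : H.IsHermitian) : cfc (fun _ : ℝ => 1) H = 1 := by
  obtain ⟨U, d, -, hU, hf, -, -⟩ := exists_spectral hH
  rw [hf]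
  simp [hU]

lemma isHermitian_cfc (H : Matrix n n ℂ) (f : ℝ → ℝ) : (cfc f H).IsHermitian :=
  cfc_predicate f H

lemma posSemidef_cfc {H : Matrix n n ℂ} (hH : H.IsHermitian) {f : ℝ → ℝ} (h : ∀ x, 0 ≤ f x) :
    (cfc f H).PosSemidef := by
  obtain ⟨U, d, -, -, hf, -, -⟩ := exists_spectral hH
  rw [hf]
  refine (PosSemidef.diagonal ?_).mul_mul_conjTranspose_same U
  intro i
  simpa using h (d i)

lemma posSemidef_cfc_of_nonneg {H : Matrix n n ℂ} (hH : H.PosSemidef) {f : ℝ → ℝ}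
    (h : ∀ x, 0 ≤ x → 0 ≤ f x) : (cfc f H).PosSemidef := by
  obtain ⟨U, d, -, -, hf, -, hp⟩ := exists_spectral hH.isHermitian
  rw [hf]
  refine (PosSemidef.diagonal ?_).mul_mul_conjTranspose_same U
  intro i
  simpa using h (d i) (hp hH i)

lemma cfc_congr_of_nonneg {H : Matrix n n ℂ} (hH : H.PosSemidef) {f g : ℝ → ℝ}
    (h : ∀ x, 0 ≤ x → f x = g x) : cfc f H = cfc g H := by
  obtain ⟨U, d, -, -, hf, -, hp⟩ := exists_spectral hH.isHermitian
  rw [hf, hf]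
  simp only [h _ (hp hH _)]

/-! ### Real traces -/

lemma trace_re_nonneg {M : Matrix n n ℂ} (hM : M.PosSemidef) : 0 ≤ M.trace.re :=
  (Complex.le_def.1 hM.trace_nonneg).1

lemma trace_im_eq_zero {M : Matrix n n ℂ} (hM : M.IsHermitian) : M.trace.im = 0 := by
  have h : star M.trace = M.trace := by rw [← trace_conjTranspose, hM.eq]
  exact Complex.conj_eq_iff_im.1 h

lemma trace_re_le {M N : Matrix n n ℂ} (h : (N - M).PosSemidef) : M.trace.re ≤ N.trace.re := by
  have := trace_re_nonneg h
  rw [trace_sub, Complex.sub_re] at this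
  linarith

lemma exists_posSemidef_mul_self {M : Matrix n n ℂ} (hM : M.PosSemidef) :
    ∃ L : Matrix n n ℂ, L.PosSemidef ∧ L * L = M := by
  refine ⟨cfc Real.sqrt M, posSemidef_cfc_of_nonneg hM fun x _ => Real.sqrt_nonneg x, ?_⟩
  rw [cfc_mul_cfc hM.isHermitian, cfc_congr_of_nonneg hM (g := fun x => x)
    (fun x hx => Real.mul_self_sqrt hx), cfc_self hM.isHermitian]

/-- `Tr M K ≥ 0` for positive semidefinite `M`, `K`. -/
lemma trace_mul_re_nonneg {M K : Matrix n n ℂ} (hM : M.PosSemidef) (hK : K.PosSemidef) :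
    0 ≤ (M * K).trace.re := by
  obtain ⟨L, hL, rfl⟩ := exists_posSemidef_mul_self hM
  have := trace_re_nonneg (hK.conjTranspose_mul_mul_same L)
  rwa [hL.isHermitian.eq, Matrix.mul_assoc, trace_mul_comm, Matrix.mul_assoc,
    trace_mul_comm] at this

lemma trace_mul_re_le_right {M K K' : Matrix n n ℂ} (hM : M.PosSemidef)
    (hK : (K' - K).PosSemidef) : (M * K).trace.re ≤ (M * K').trace.re := by
  have := trace_mul_re_nonneg hM hK
  rw [mul_sub, trace_sub, Complex.sub_re] at this
  linarith

/-! ### Hilbert-Schmidt geometry. -/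

/-- The squared Hilbert-Schmidt norm. -/
def hsSq (X : Matrix n n ℂ) : ℝ := (X * Xᴴ).trace.re

lemma hsSq_nonneg (X : Matrix n n ℂ) : 0 ≤ hsSq X :=
  trace_re_nonneg (posSemidef_self_mul_conjTranspose X)

lemma trace_mul_conjTranspose_re_comm (X Y : Matrix n n ℂ) :
    (Y * Xᴴ).trace.re = (X * Yᴴ).trace.re := by
  rw [show Y * Xᴴ = (X * Yᴴ)ᴴ by simp, trace_conjTranspose]
  simp

lemma hsSq_add (X Y : Matrix n n ℂ) :
    hsSq (X + Y) = hsSq X + hsSq Y + 2 * (X * Yᴴ).trace.re := by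
  have := trace_mul_conjTranspose_re_comm X Y
  simp only [hsSq, conjTranspose_add, add_mul, mul_add, trace_add, Complex.add_re]
  linarith

lemma hsSq_sub (X Y : Matrix n n ℂ) :
    hsSq (X - Y) = hsSq X + hsSq Y - 2 * (X * Yᴴ).trace.re := by
  have := trace_mul_conjTranspose_re_comm X Y
  simp only [hsSq, conjTranspose_sub, sub_mul, mul_sub, trace_sub, Complex.sub_re]
  linarith

lemma hsSq_real_smul (a : ℝ) (X : Matrix n n ℂ) : hsSq (a • X) = a ^ 2 * hsSq X := by
  simp only [hsSq, conjTranspose_smul, star_trivial, smul_mul_assoc, mul_smul_comm, smul_smul,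
    trace_smul, Complex.smul_re, smul_eq_mul]
  ring

/-- The Cauchy-Schwarz inequality for the Hilbert-Schmidt inner product. -/
lemma trace_mul_conjTranspose_re_le (X Y : Matrix n n ℂ) :
    (X * Yᴴ).trace.re ≤ √(hsSq X) * √(hsSq Y) := by
  have key : ∀ a b : ℝ, 0 ≤ a ^ 2 * hsSq X + b ^ 2 * hsSq Y - 2 * (a * b * (X * Yᴴ).trace.re) := by
    intro a b
    have h := hsSq_nonneg (a • X - b • Y)
    rw [hsSq_sub, hsSq_real_smul, hsSq_real_smul] at h
    simpa [conjTranspose_smul, smul_mul_assoc, mul_smul_comm, smul_smul, mul_assoc, mul_comm,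
      mul_left_comm] using h
  have hx := Real.sq_sqrt (hsSq_nonneg X)
  have hy := Real.sq_sqrt (hsSq_nonneg Y)
  rw [← Real.sqrt_mul (hsSq_nonneg X)]
  apply Real.le_sqrt_of_sq_le
  set t := (X * Yᴴ).trace.re
  have hX := hsSq_nonneg X
  rcases hX.eq_or_lt with h0 | h0
  · by_contra hne
    rw [← h0] at hne
    have ht : t ≠ 0 := by
      rintro h
      simp [h] at hne
    have := key ((hsSq Y + 1) / t) 1
    rw [← h0] at this
    have e : (hsSq Y + 1) / t * 1 * t = hsSq Y + 1 := by field_simp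
    rw [e] at this
    have := hsSq_nonneg Y
    linarith
  -- This choice turns the quadratic form into `hsSq X * (hsSq X * hsSq Y - t ^ 2)`.
  · have := key t (hsSq X)
    have h2 : 0 ≤ hsSq X * (hsSq X * hsSq Y - t ^ 2) := by nlinarith
    have := nonneg_of_mul_nonneg_right h2 h0
    linarith

/-- Right multiplication by a contraction does not increase the Hilbert-Schmidt norm. -/
lemma hsSq_mul_le {Z G : Matrix n n ℂ} (hG : (1 - G * Gᴴ).PosSemidef) :
    hsSq (Z * G) ≤ hsSq Z := by
  have h := trace_re_nonneg (hG.mul_mul_conjTranspose_same Z)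
  have e : Z * (1 - G * Gᴴ) * Zᴴ = Z * Zᴴ - Z * G * (Z * G)ᴴ := by
    rw [conjTranspose_mul]; noncomm_ring
  rw [e, trace_sub, Complex.sub_re] at h
  simp only [hsSq]
  linarith

/-- The difference of `V Vᴴ` and `W Wᴴ` on a projection, in terms of the Hilbert-Schmidt
distance of `V` and `W`. -/
lemma trace_proj_mul_sub_re_le {p V W : Matrix n n ℂ} (hp : p.IsHermitian) (hpp : p * p = p) :
    (p * (V * Vᴴ - W * Wᴴ)).trace.re ≤
      (hsSq V - hsSq W) / 2 + √(hsSq (V - W)) * √(hsSq (V + W)) / 2 := by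
  -- The reflection `R` is unitary, so it costs nothing in Cauchy-Schwarz for `R (V - W)` against `V
  -- + W`. The cross terms are adjoint up to cyclicity and cancel in the real trace.
  set R : Matrix n n ℂ := p + p - 1 with hR
  have hRh : Rᴴ = R := by simp [hR, hp.eq]
  have hRR : R * R = 1 := by
    rw [hR]
    have : (p + p - 1) * (p + p - 1) = (p * p + p * p + p * p + p * p) - p - p - p - p + 1 := by
      noncomm_ring
    rw [this, hpp]
    abel
  have h1 : hsSq (R * (V - W)) = hsSq (V - W) := by
    rw [hsSq, conjTranspose_mul, hRh, hsSq]
    rw [show R * (V - W) * ((V - W)ᴴ * R) = R * ((V - W) * (V - W)ᴴ) * R by noncomm_ring,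
      trace_mul_comm, ← Matrix.mul_assoc, hRR, Matrix.one_mul]
  have h2 := trace_mul_conjTranspose_re_le (R * (V - W)) (V + W)
  rw [h1] at h2
  have h3 : (R * (V * Wᴴ)).trace.re = (R * (W * Vᴴ)).trace.re := by
    have : (R * (V * Wᴴ))ᴴ = W * Vᴴ * R := by
      simp only [conjTranspose_mul, conjTranspose_conjTranspose, hRh]
    rw [trace_mul_comm R (W * Vᴴ), ← this, trace_conjTranspose]
    simp
  have h4 : R * (V - W) * (V + W)ᴴ
      = R * (V * Vᴴ - W * Wᴴ) + R * (V * Wᴴ) - R * (W * Vᴴ) := by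
    rw [conjTranspose_add]; noncomm_ring
  rw [h4, trace_sub, trace_add, Complex.sub_re, Complex.add_re, h3] at h2
  have h5 : R * (V * Vᴴ - W * Wᴴ) = p * (V * Vᴴ - W * Wᴴ) + p * (V * Vᴴ - W * Wᴴ)
      - (V * Vᴴ - W * Wᴴ) := by rw [hR]; noncomm_ring
  rw [h5, trace_sub, trace_add, trace_sub, Complex.sub_re, Complex.add_re, Complex.sub_re] at h2
  simp only [hsSq] at h2 ⊢
  linarith

/-! ### Positive parts -/

/-- The projection onto the positive eigenspaces. -/
def posProj (H : Matrix n n ℂ) : Matrix n n ℂ := cfc (fun x : ℝ => if 0 < x then 1 else 0) H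

/-- The positive part. -/
def posPart (H : Matrix n n ℂ) : Matrix n n ℂ := cfc (fun x : ℝ => max x 0) H

lemma isHermitian_posProj (H : Matrix n n ℂ) : (posProj H).IsHermitian := isHermitian_cfc _ _

lemma posProj_mul_self {H : Matrix n n ℂ} (hH : H.IsHermitian) :
    posProj H * posProj H = posProj H := by
  rw [posProj, cfc_mul_cfc hH]
  congr 1
  ext x
  split_ifs <;> simp

lemma posPart_eq {H : Matrix n n ℂ} (hH : H.IsHermitian) : posPart H = posProj H * H := by
  rw [posPart, posProj, cfc_mul_self_right hH]
  congr 1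
  ext x
  split_ifs with h
  · simp [h.le]
  · simp [not_lt.1 h]

lemma posSemidef_posPart {H : Matrix n n ℂ} (hH : H.IsHermitian) : (posPart H).PosSemidef :=
  posSemidef_cfc hH fun _ => le_max_right _ _

lemma posSemidef_posPart_sub {H : Matrix n n ℂ} (hH : H.IsHermitian) :
    (posPart H - H).PosSemidef := by
  nth_rw 2 [← cfc_self hH]
  rw [posPart, cfc_sub_cfc hH]
  exact posSemidef_cfc hH fun x => sub_nonneg.2 (le_max_left _ _)

/-- The projection has the form `f(H) H`, so it absorbs on the right whatever `H` absorbs. -/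
lemma posProj_mul_of_mul_eq {H p : Matrix n n ℂ} (hH : H.IsHermitian) (h : H * p = H) :
    posProj H * p = posProj H := by
  have e : posProj H = cfc (fun x : ℝ => if 0 < x then x⁻¹ else 0) H * H := by
    rw [posProj, cfc_mul_self_right hH]
    congr 1
    ext x
    split_ifs with hx
    · field_simp
    · simp
  rw [e, Matrix.mul_assoc, h]

/-- Since `|x| = 2 max x 0 - x`, vanishing trace leaves twice the trace of the positive part. -/
lemma half_traceNorm_eq {H : Matrix n n ℂ} (hH : H.IsHermitian) (h0 : H.trace.re = 0) :
    1 / 2 * traceNorm H = (posProj H * H).trace.re := by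
  have h1 : cfc Real.sqrt (Hᴴ * H) = posPart H + posPart H - H := by
    have : Hᴴ * H = cfc (fun x : ℝ => x * x) H := by
      rw [hH.eq]
      nth_rw 1 [← cfc_self hH]
      rw [cfc_mul_self_right hH]
    have hc : ContinuousOn Real.sqrt ((fun x : ℝ => x * x) '' spectrum ℝ H) :=
      Real.continuous_sqrt.continuousOn
    have h2 := cfc_comp' Real.sqrt (fun x : ℝ => x * x) H hc (by fun_prop) hH
    rw [this]
    refine h2.symm.trans ?_
    nth_rw 4 [← cfc_self hH]
    rw [posPart, cfc_add_cfc hH, cfc_sub_cfc hH]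
    congr 1
    ext x
    rw [Real.sqrt_mul_self_eq_abs]
    rcases le_total 0 x with h | h
    · rw [abs_of_nonneg h, max_eq_left h]; ring
    · rw [abs_of_nonpos h, max_eq_right h]; ring
  rw [traceNorm, h1, trace_sub, trace_add, Complex.sub_re, Complex.add_re, h0, posPart_eq hH]
  ring

/-- The trace distance bound from a bound on the distinguishing advantage of projections. -/
lemma half_traceNorm_sub_le {M N : Matrix n n ℂ} {e : ℝ} (hM : M.IsHermitian)
    (hN : N.IsHermitian) (htr : M.trace = N.trace)
    (h : ∀ p : Matrix n n ℂ, p.IsHermitian → p * p = p → (p * (M - N)).trace.re ≤ e) :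
    1 / 2 * traceNorm (M - N) ≤ e := by
  rw [half_traceNorm_eq (hM.sub hN) (by simp [trace_sub, htr])]
  exact h _ (isHermitian_posProj _) (posProj_mul_self (hM.sub hN))

/-- With equal traces, testing `M - N` on `p` is testing `N - M` on the complement `1 - p`. -/
lemma half_traceNorm_sub_le' {M N : Matrix n n ℂ} {e : ℝ} (hM : M.IsHermitian)
    (hN : N.IsHermitian) (htr : M.trace = N.trace)
    (h : ∀ p : Matrix n n ℂ, p.IsHermitian → p * p = p → (p * (N - M)).trace.re ≤ e) :
    1 / 2 * traceNorm (M - N) ≤ e := by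
  refine half_traceNorm_sub_le hM hN htr fun p hp hpp => ?_
  have := h (1 - p) (isHermitian_one.sub hp) (by
    rw [sub_mul, mul_sub, mul_sub, hpp]; simp)
  rw [sub_mul, Matrix.one_mul, trace_sub, trace_sub, htr, sub_self, Complex.sub_re] at this
  rw [show p * (M - N) = - (p * (N - M)) by noncomm_ring, trace_neg, Complex.neg_re]
  simpa using this

/-! ### Trace inequalities -/

lemma conj_diagonal_apply_re (C : Matrix n n ℂ) (x : n → ℝ) (k : n) :
    ((Cᴴ * diagonal (fun i => (x i : ℂ)) * C) k k).re = ∑ i, Complex.normSq (C i k) * x i := by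
  rw [Matrix.mul_apply, Complex.re_sum]
  refine Finset.sum_congr rfl fun i _ => ?_
  rw [mul_diagonal, conjTranspose_apply, Complex.star_def, Complex.normSq_apply]
  simp
  ring

lemma apply_re_nonneg {M : Matrix n n ℂ} (hM : M.PosSemidef) (k : n) : 0 ≤ (M k k).re :=
  (Complex.le_def.1 (hM.diag_nonneg (i := k))).1

lemma trace_re_eq_sum (M : Matrix n n ℂ) : M.trace.re = ∑ k, (M k k).re := by
  simp [Matrix.trace, Complex.re_sum]

/-- Powers-Størmer for ordered squares. In an eigenbasis of `X - Y`, with eigenvalues `z k`, the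
diagonal of `X² - Y²` is `z k * C k k`, where `C` represents `X + Y` and its diagonal dominates `|z
k|`. -/
lemma hsSq_le_trace_sub {X Y : Matrix n n ℂ} (hX : X.PosSemidef) (hY : Y.PosSemidef)
    (h : (X * X - Y * Y).PosSemidef) : hsSq (X - Y) ≤ (X * X - Y * Y).trace.re := by
  have hZ : (X - Y).IsHermitian := hX.isHermitian.sub hY.isHermitian
  obtain ⟨U, z, hU, hU', -, hz, -⟩ := exists_spectral hZ
  set D : Matrix n n ℂ := diagonal (fun i => (z i : ℂ)) with hD
  have hUZ : Uᴴ * (X - Y) * U = D := by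
    rw [hz, show Uᴴ * (U * D * Uᴴ) * U = (Uᴴ * U) * D * (Uᴴ * U) by noncomm_ring, hU]
    simp
  set C : Matrix n n ℂ := Uᴴ * (X + Y) * U with hC
  have h1 : ∀ k, 0 ≤ (C k k).re - z k := by
    intro k
    have := apply_re_nonneg ((hY.add hY).conjTranspose_mul_mul_same U) k
    rw [show Uᴴ * (Y + Y) * U = C - Uᴴ * (X - Y) * U by rw [hC]; noncomm_ring, hUZ] at this
    simpa [hD] using this
  have h2 : ∀ k, 0 ≤ (C k k).re + z k := by
    intro k
    have := apply_re_nonneg ((hX.add hX).conjTranspose_mul_mul_same U) k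
    rw [show Uᴴ * (X + X) * U = C + Uᴴ * (X - Y) * U by rw [hC]; noncomm_ring, hUZ] at this
    simpa [hD] using this
  -- `2 (X² - Y²)` is the anticommutator of `X - Y` and `X + Y`.
  have e : (Uᴴ * (X * X - Y * Y) * U) + (Uᴴ * (X * X - Y * Y) * U) = D * C + C * D := by
    rw [← hUZ, hC]
    rw [show Uᴴ * (X - Y) * U * (Uᴴ * (X + Y) * U) = Uᴴ * (X - Y) * (U * Uᴴ) * (X + Y) * U by
      noncomm_ring, show Uᴴ * (X + Y) * U * (Uᴴ * (X - Y) * U)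
        = Uᴴ * (X + Y) * (U * Uᴴ) * (X - Y) * U by noncomm_ring, hU']
    noncomm_ring
  have h3 : ∀ k, ((Uᴴ * (X * X - Y * Y) * U) k k).re = z k * (C k k).re := by
    intro k
    have := congrArg (fun M : Matrix n n ℂ => (M k k).re) e
    simp only [Matrix.add_apply, hD, diagonal_mul, mul_diagonal, Complex.add_re, Complex.mul_re,
      Complex.ofReal_re, Complex.ofReal_im] at this
    linarith
  have h4 : (X * X - Y * Y).trace.re = ∑ k, z k * (C k k).re := by
    rw [← Finset.sum_congr rfl fun k _ => h3 k, ← trace_re_eq_sum, trace_mul_comm,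
      ← Matrix.mul_assoc, hU', Matrix.one_mul]
  have h5 : hsSq (X - Y) = ∑ k, z k * z k := by
    rw [hsSq, hZ.eq, hz, conj_diagonal_mul hU, trace_mul_comm, ← Matrix.mul_assoc, hU,
      Matrix.one_mul, trace_diagonal, Complex.re_sum]
    simp
  rw [h4, h5]
  refine Finset.sum_le_sum fun k _ => ?_
  have h6 : 0 ≤ z k * (C k k).re := h3 k ▸ apply_re_nonneg (h.conjTranspose_mul_mul_same U) k
  have h7 := h1 k
  have h8 := h2 k
  rcases le_or_gt 0 (z k) with hk | hk
  · nlinarith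
  · nlinarith

/-- Jensen's inequality for the diagonal entries of a compression. -/
lemma conj_cfc_apply_rpow_le {H W : Matrix n n ℂ} (hH : H.PosSemidef) {f : ℝ → ℝ}
    (hf : ∀ x, 0 ≤ x → 0 ≤ f x) {p : ℝ} (hp : 1 ≤ p) {k : n} (hW : ((Wᴴ * W) k k).re ≤ 1) :
    ((Wᴴ * cfc f H * W) k k).re ^ p ≤ ((Wᴴ * cfc (fun x => f x ^ p) H * W) k k).re := by
  obtain ⟨U, d, hU, hU', hc, -, hd⟩ := exists_spectral hH.isHermitian
  have key : ∀ g : ℝ → ℝ, ((Wᴴ * cfc g H * W) k k).re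
      = ∑ i, Complex.normSq ((Uᴴ * W) i k) * g (d i) := by
    intro g
    rw [← conj_diagonal_apply_re, hc, conjTranspose_mul, conjTranspose_conjTranspose]
    simp only [Matrix.mul_assoc]
  have hw : ∑ i, Complex.normSq ((Uᴴ * W) i k) ≤ 1 := by
    have := key (fun _ => 1)
    rw [cfc_one_eq hH.isHermitian] at this
    simp only [mul_one] at this
    rwa [← this]
  rw [key, key]
  have hw0 : 0 ≤ ∑ i, Complex.normSq ((Uᴴ * W) i k) :=
    Finset.sum_nonneg fun i _ => Complex.normSq_nonneg _
  have h1 := Real.inner_le_weight_mul_Lp_of_nonneg Finset.univ hp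
    (fun i => Complex.normSq ((Uᴴ * W) i k)) (fun i => f (d i)) (fun i => Complex.normSq_nonneg _)
    (fun i => hf _ (hd hH i))
  have hs : 0 ≤ ∑ i, Complex.normSq ((Uᴴ * W) i k) * f (d i) ^ p :=
    Finset.sum_nonneg fun i _ => mul_nonneg (Complex.normSq_nonneg _)
      (Real.rpow_nonneg (hf _ (hd hH i)) _)
  -- The weights have total at most one, so the prefactor in the weighted Hölder inequality can be
  -- dropped.
  have h2 : (∑ i, Complex.normSq ((Uᴴ * W) i k)) ^ (1 - p⁻¹) ≤ 1 :=
    Real.rpow_le_one hw0 hw (sub_nonneg.2 (inv_le_one_of_one_le₀ hp))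
  have h3 : ∑ i, Complex.normSq ((Uᴴ * W) i k) * f (d i)
      ≤ (∑ i, Complex.normSq ((Uᴴ * W) i k) * f (d i) ^ p) ^ p⁻¹ :=
    h1.trans (mul_le_of_le_one_left (Real.rpow_nonneg hs _) h2)
  have h4 : 0 ≤ ∑ i, Complex.normSq ((Uᴴ * W) i k) * f (d i) :=
    Finset.sum_nonneg fun i _ => mul_nonneg (Complex.normSq_nonneg _) (hf _ (hd hH i))
  calc _ ≤ ((∑ i, Complex.normSq ((Uᴴ * W) i k) * f (d i) ^ p) ^ p⁻¹) ^ p :=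
        Real.rpow_le_rpow h4 h3 (by linarith)
    _ = _ := Real.rpow_inv_rpow hs (by linarith)

lemma posSemidef_of_isHermitian_of_mul_self {p : Matrix n n ℂ} (hp : p.IsHermitian)
    (hpp : p * p = p) : p.PosSemidef := by
  have := posSemidef_self_mul_conjTranspose p
  rwa [hp.eq, hpp] at this

/-- A partial isometry is a contraction. -/
lemma posSemidef_one_sub_mul_conjTranspose {W E : Matrix n n ℂ} (hE : Wᴴ * W = E)
    (hEE : E * E = E) : (1 - W * Wᴴ).PosSemidef := by
  have hEh : Eᴴ = E := by rw [← hE]; simp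
  have hWE : W * E = W := by
    have : (W * E - W)ᴴ * (W * E - W) = 0 := by
      rw [conjTranspose_sub, conjTranspose_mul, hEh]
      rw [show (E * Wᴴ - Wᴴ) * (W * E - W) = E * (Wᴴ * W) * E - E * (Wᴴ * W) - (Wᴴ * W) * E
        + Wᴴ * W by noncomm_ring, hE, hEE, hEE]
      abel
    exact sub_eq_zero.1 (conjTranspose_mul_self_eq_zero.1 this)
  refine posSemidef_of_isHermitian_of_mul_self ?_ ?_
  · exact isHermitian_one.sub (isHermitian_mul_conjTranspose_self W)
  · rw [show (1 - W * Wᴴ) * (1 - W * Wᴴ) = 1 - W * Wᴴ - W * Wᴴ + W * (Wᴴ * W) * Wᴴ by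
      noncomm_ring, hE, hWE]
    abel

/-! ### Polar and Douglas factorizations. -/

/-- Every square matrix factors through a partial isometry in the eigenbasis of `Xᴴ X`. -/
lemma exists_singular (X : Matrix n n ℂ) : ∃ (U W : Matrix n n ℂ) (g : n → ℝ),
    U * Uᴴ = 1 ∧ Uᴴ * U = 1 ∧ (∀ i, 0 ≤ g i) ∧
    Uᴴ * (Xᴴ * X) * U = diagonal (fun i => (g i : ℂ)) ∧
    X * U = W * diagonal (fun i => ((√(g i) : ℝ) : ℂ)) ∧ (1 - W * Wᴴ).PosSemidef ∧
    ∀ k, ((Wᴴ * W) k k).re ≤ 1 := by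
  have hp := posSemidef_conjTranspose_mul_self X
  obtain ⟨U, g, hU, hU', -, hg, hg0⟩ := exists_spectral hp.isHermitian
  have hg0 := hg0 hp
  have hD : Uᴴ * (Xᴴ * X) * U = diagonal (fun i => (g i : ℂ)) := by
    rw [hg, show Uᴴ * (U * diagonal (fun i => (g i : ℂ)) * Uᴴ) * U
      = (Uᴴ * U) * diagonal (fun i => (g i : ℂ)) * (Uᴴ * U) by noncomm_ring, hU]
    simp
  -- As `0⁻¹ = 0`, `s` inverts `√g` on its support only, and `e` is the indicator of that support.
  set s : n → ℂ := fun i => (((√(g i))⁻¹ : ℝ) : ℂ) with hs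
  set e : n → ℂ := fun i => if g i = 0 then 0 else 1 with he
  have hXU : (X * U)ᴴ * (X * U) = diagonal (fun i => (g i : ℂ)) := by
    rw [← hD, conjTranspose_mul]; noncomm_ring
  have hsg : ∀ i, s i * (g i : ℂ) * s i = e i := by
    intro i
    simp only [hs, he]
    split_ifs with h
    · simp [h]
    · have : √(g i) ≠ 0 := (Real.sqrt_pos.2 ((hg0 i).lt_of_ne' h)).ne'
      have h2 : (√(g i))⁻¹ * g i * (√(g i))⁻¹ = 1 := by
        nth_rw 2 [← Real.mul_self_sqrt (hg0 i)]
        field_simp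
      exact_mod_cast h2
  have hWW : (X * U * diagonal s)ᴴ * (X * U * diagonal s) = diagonal e := by
    rw [conjTranspose_mul, show (diagonal s)ᴴ * (X * U)ᴴ * (X * U * diagonal s)
      = (diagonal s)ᴴ * ((X * U)ᴴ * (X * U)) * diagonal s by noncomm_ring, hXU,
      diagonal_conjTranspose, diagonal_mul_diagonal, diagonal_mul_diagonal]
    congr 1
    ext i
    rw [← hsg]
    simp [hs]
  refine ⟨U, X * U * diagonal s, g, hU', hU, hg0, hD, ?_, ?_, ?_⟩
  · have h0 : ((X * U) - (X * U) * diagonal e)ᴴ * ((X * U) - (X * U) * diagonal e) = 0 := by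
      rw [conjTranspose_sub, conjTranspose_mul (X * U), show ((X * U)ᴴ - (diagonal e)ᴴ * (X * U)ᴴ)
        * ((X * U) - (X * U) * diagonal e) = (X * U)ᴴ * (X * U)
          - (X * U)ᴴ * (X * U) * diagonal e - (diagonal e)ᴴ * ((X * U)ᴴ * (X * U))
          + (diagonal e)ᴴ * ((X * U)ᴴ * (X * U)) * diagonal e by noncomm_ring, hXU,
        diagonal_conjTranspose, diagonal_mul_diagonal, diagonal_mul_diagonal,
        diagonal_mul_diagonal, diagonal_sub, diagonal_sub, diagonal_add, ← diagonal_zero]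
      congr 1
      ext i
      by_cases h : g i = 0 <;> simp [he, h]
    have h1 := sub_eq_zero.1 (conjTranspose_mul_self_eq_zero.1 h0)
    rw [Matrix.mul_assoc, diagonal_mul_diagonal]
    conv_lhs => rw [h1]
    congr 2
    ext i
    simp only [he, hs]
    split_ifs with h
    · simp [h]
    · have : √(g i) ≠ 0 := (Real.sqrt_pos.2 ((hg0 i).lt_of_ne' h)).ne'
      have h2 : (√(g i))⁻¹ * √(g i) = 1 := inv_mul_cancel₀ this
      exact_mod_cast h2.symm
  · refine posSemidef_one_sub_mul_conjTranspose hWW ?_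
    rw [diagonal_mul_diagonal]
    congr 1
    ext i
    by_cases h : g i = 0 <;> simp [he, h]
  · intro k
    rw [hWW]
    by_cases h : g k = 0 <;> simp [he, h]

/-- Douglas factorization: if `V Vᴴ ≤ X²` then `V = X G` with a contraction `G`. -/
lemma exists_contraction {X V : Matrix n n ℂ} (hX : X.PosSemidef)
    (h : (X * X - V * Vᴴ).PosSemidef) :
    ∃ G : Matrix n n ℂ, X * G = V ∧ (1 - G * Gᴴ).PosSemidef := by
  have hXh := hX.isHermitian
  -- The convention `0⁻¹ = 0` makes `J` the pseudo-inverse of `X`, and `E = X J` its support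
  -- projection.
  set J : Matrix n n ℂ := cfc (fun x : ℝ => x⁻¹) X with hJ
  have hJh : Jᴴ = J := isHermitian_cfc _ _
  set E : Matrix n n ℂ := X * J with hE
  have hE' : E = cfc (fun x : ℝ => x * x⁻¹) X := by rw [hE, hJ, cfc_mul_self_left hXh]
  have hEh : Eᴴ = E := by rw [hE']; exact isHermitian_cfc _ _
  have hEE : E * E = E := by
    rw [hE', cfc_mul_cfc hXh]
    congr 1
    ext x
    by_cases hx : x = 0 <;> simp [hx]
  have hEX : E * X = X := by
    rw [hE', cfc_mul_self_right hXh]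
    conv_rhs => rw [← cfc_self hXh]
    congr 1
    ext x
    by_cases hx : x = 0 <;> simp [hx]
  have hJE : J * X = E := by
    rw [hE', hJ, cfc_mul_self_right hXh]
    congr 1
    ext x
    ring
  -- Compressing the hypothesis to the kernel of `X` kills `X²` and leaves a positive semidefinite
  -- `-((1 - E) V) ((1 - E) V)ᴴ`, which must vanish.
  have hEV : E * V = V := by
    have h1 := h.mul_mul_conjTranspose_same (1 - E)
    have h2 : (1 - E) * (X * X - V * Vᴴ) * (1 - E)ᴴ
        = -(((1 - E) * V) * ((1 - E) * V)ᴴ) := by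
      rw [conjTranspose_mul, show (1 - E) * (X * X - V * Vᴴ) * (1 - E)ᴴ
        = (X - E * X) * X * (1 - E)ᴴ - (1 - E) * V * (Vᴴ * (1 - E)ᴴ) by noncomm_ring, hEX]
      simp
    rw [h2] at h1
    have h3 : (((1 - E) * V) * ((1 - E) * V)ᴴ).trace = 0 := by
      have ha := (posSemidef_self_mul_conjTranspose ((1 - E) * V)).trace_nonneg
      have hb := h1.trace_nonneg
      rw [trace_neg] at hb
      exact le_antisymm (by simpa using hb) ha
    have h4 := trace_mul_conjTranspose_self_eq_zero_iff.1 h3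
    rw [sub_mul, Matrix.one_mul, sub_eq_zero] at h4
    exact h4.symm
  refine ⟨J * V, ?_, ?_⟩
  · rw [← Matrix.mul_assoc, ← hE, hEV]
  · have h1 := h.mul_mul_conjTranspose_same J
    have h2 : (1 - E).PosSemidef := by
      refine posSemidef_of_isHermitian_of_mul_self (isHermitian_one.sub hEh) ?_
      rw [sub_mul, mul_sub, mul_sub, hEE]
      simp
    have h3 := h1.add h2
    convert h3 using 1
    rw [conjTranspose_mul, hJh, show J * (X * X - V * Vᴴ) * J + (1 - E)
      = (J * X) * (X * J) - J * V * (Vᴴ * J) + (1 - E) by noncomm_ring, hJE, ← hE, hEE]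
    abel

/-! ### Rényi test inequality. -/

/-- The data-processing inequality of the sandwiched Rényi quantity under a projective test. -/
lemma trace_proj_rpow_le {β : ℝ} (hβ : 1 < β) {ρ τ p : Matrix n n ℂ} (hρ : ρ.PosSemidef)
    (hτ : τ.PosSemidef) (hsupp : SuppLE ρ τ) (hp : p.IsHermitian) (hpp : p * p = p) :
    (p * ρ).trace.re ^ β ≤ Q β ρ τ * (p * τ).trace.re ^ (β - 1) := by
  set s : ℝ := (1 - β) / (2 * β) with hs
  have hs0 : s ≠ 0 := (div_neg_of_neg_of_pos (by linarith) (by linarith)).ne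
  have hτh := hτ.isHermitian
  set T : Matrix n n ℂ := mpow τ s with hT
  set T' : Matrix n n ℂ := mpow τ (-s) with hT'
  have hTh : Tᴴ = T := isHermitian_cfc _ _
  have hTh' : T'ᴴ = T' := isHermitian_cfc _ _
  have hpow : ∀ x : ℝ, 0 ≤ x → x ^ (-s) * x ^ s * x = x := by
    intro x hx
    rcases hx.eq_or_lt with rfl | hx
    · simp
    · rw [← Real.rpow_add hx]; simp
  have hTTτ : T' * T * τ = τ := by
    rw [hT, hT', mpow, mpow, cfc_mul_cfc hτh, cfc_mul_self_right hτh]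
    conv_rhs => rw [← cfc_self hτh]
    exact cfc_congr_of_nonneg hτ hpow
  have hTTρ : T' * T * ρ = ρ := by
    have : ∀ v, (T' * T) *ᵥ (ρ *ᵥ v) = ρ *ᵥ v := by
      intro v
      obtain ⟨w, hw⟩ : ρ *ᵥ v ∈ LinearMap.range τ.mulVecLin := hsupp ⟨v, rfl⟩
      rw [mulVecLin_apply] at hw
      rw [← hw, mulVec_mulVec, hTTτ]
    apply Matrix.mulVec_injective
    ext1 v
    rw [← mulVec_mulVec, this]
  have hρTT : ρ * (T * T') = ρ := by
    have := congrArg conjTranspose hTTρ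
    rwa [conjTranspose_mul, conjTranspose_mul, hTh, hTh', hρ.isHermitian.eq] at this
  set M : Matrix n n ℂ := T * ρ * T with hM
  have hMp : M.PosSemidef := by
    have := hρ.mul_mul_conjTranspose_same T
    rwa [hTh] at this
  have hρM : T' * M * T' = ρ := by
    rw [hM, show T' * (T * ρ * T) * T' = (T' * T * ρ) * (T * T') by noncomm_ring, hTTρ, hρTT]
  -- Now `p ρ p = Xᴴ M X`. In the singular basis of `X` its trace is a sum of products of diagonal
  -- entries of `Wᴴ M W` with the squared singular values `g`, ready for Hölder with exponents `β`
  -- and `γ`.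
  set X : Matrix n n ℂ := T' * p with hX
  have hXh : Xᴴ = p * T' := by rw [hX, conjTranspose_mul, hTh', hp.eq]
  obtain ⟨U, W, g, hU, hU', hg, hgD, hXU, hW1, hWk⟩ := exists_singular X
  set γ : ℝ := β / (β - 1) with hγ
  have hβ1 : 0 < β - 1 := by linarith
  have hconj : β.HolderConjugate γ := Real.HolderConjugate.conjExponent hβ
  have hγ1 : 1 < γ := hconj.symm.lt
  -- the first Hölder factor
  have hgk : ∀ k, g k ^ γ ≤ ((Uᴴ * p * τ * p * U) k k).re := by
    intro k
    -- The sandwiching exponent satisfies `-2 s = (β - 1) / β = 1 / γ`, so Jensen at power `γ`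
    -- recovers `τ` itself.
    have hTT : T' * T' = cfc (fun x : ℝ => x ^ γ⁻¹) τ := by
      rw [hT', mpow, cfc_mul_cfc hτh]
      refine cfc_congr_of_nonneg hτ fun x hx => ?_
      have hγs : γ⁻¹ = -s + -s := by
        rw [hγ, hs, inv_div]; field_simp; ring
      have hne : -s + -s ≠ 0 := by
        intro h; apply hs0; linarith
      rw [hγs, Real.rpow_add' hx hne]
    have h1 : (((p * U)ᴴ * (p * U)) k k).re ≤ 1 := by
      have h2 := apply_re_nonneg ((posSemidef_of_isHermitian_of_mul_self
        (isHermitian_one.sub hp) (by rw [sub_mul, mul_sub, mul_sub, hpp]; simp :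
          (1 - p) * (1 - p) = 1 - p)).conjTranspose_mul_mul_same U) k
      have h3 : (p * U)ᴴ * (p * U) = 1 - Uᴴ * (1 - p) * U := by
        rw [conjTranspose_mul, hp.eq, show Uᴴ * p * (p * U) = Uᴴ * (p * p) * U by noncomm_ring,
          hpp, show Uᴴ * (1 - p) * U = Uᴴ * U - Uᴴ * p * U by noncomm_ring, hU']
        abel
      rw [h3]
      simpa using h2
    have h4 := conj_cfc_apply_rpow_le hτ (f := fun x : ℝ => x ^ γ⁻¹)
      (fun x hx => Real.rpow_nonneg hx _) hγ1.le h1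
    have h5 : cfc (fun x : ℝ => (x ^ γ⁻¹) ^ γ) τ = τ := by
      conv_rhs => rw [← cfc_self hτh]
      exact cfc_congr_of_nonneg hτ fun x hx => Real.rpow_inv_rpow hx (by linarith)
    rw [h5, ← hTT] at h4
    have h6 : (p * U)ᴴ * (T' * T') * (p * U) = Uᴴ * (Xᴴ * X) * U := by
      rw [conjTranspose_mul, hp.eq, hXh, hX]; noncomm_ring
    have h7 : (p * U)ᴴ * τ * (p * U) = Uᴴ * p * τ * p * U := by
      rw [conjTranspose_mul, hp.eq]; noncomm_ring
    rw [h6, h7, hgD, diagonal_apply_eq, Complex.ofReal_re] at h4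
    exact h4
  have hgsum : ∑ k, g k ^ γ ≤ (p * τ).trace.re := by
    calc _ ≤ ∑ k, ((Uᴴ * p * τ * p * U) k k).re := Finset.sum_le_sum fun k _ => hgk k
      _ = (p * τ).trace.re := by
        rw [← trace_re_eq_sum, trace_mul_comm, show U * (Uᴴ * p * τ * p) = (U * Uᴴ) * (p * τ * p)
          by noncomm_ring, hU, Matrix.one_mul, trace_mul_comm, ← Matrix.mul_assoc, hpp]
  -- the second Hölder factor
  have hm0 : ∀ k, 0 ≤ ((Wᴴ * M * W) k k).re := fun k =>
    apply_re_nonneg (hMp.conjTranspose_mul_mul_same W) k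
  have hmsum : ∑ k, ((Wᴴ * M * W) k k).re ^ β ≤ Q β ρ τ := by
    have h1 : ∀ k, ((Wᴴ * M * W) k k).re ^ β ≤ ((Wᴴ * mpow M β * W) k k).re := by
      intro k
      have := conj_cfc_apply_rpow_le hMp (f := fun x : ℝ => x) (fun x hx => hx) hβ.le (hWk k)
      rwa [cfc_self hMp.isHermitian] at this
    have h2 : (mpow M β).PosSemidef :=
      posSemidef_cfc_of_nonneg hMp fun x hx => Real.rpow_nonneg hx _
    calc _ ≤ ∑ k, ((Wᴴ * mpow M β * W) k k).re := Finset.sum_le_sum fun k _ => h1 k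
      _ = (mpow M β * (W * Wᴴ)).trace.re := by
        rw [← trace_re_eq_sum, Matrix.mul_assoc, trace_mul_comm, Matrix.mul_assoc]
      _ ≤ (mpow M β * 1).trace.re := trace_mul_re_le_right h2 hW1
      _ = Q β ρ τ := by rw [Matrix.mul_one, Q]
  have htr : (p * ρ).trace.re = ∑ k, ((Wᴴ * M * W) k k).re * g k := by
    have h1 : (p * ρ).trace = ((X * U)ᴴ * M * (X * U)).trace := by
      rw [show (X * U)ᴴ * M * (X * U) = Uᴴ * (Xᴴ * M * X) * U by
        rw [conjTranspose_mul]; noncomm_ring, trace_mul_comm _ U, ← Matrix.mul_assoc, hU,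
        Matrix.one_mul, hXh, hX, show p * T' * M * (T' * p) = p * (T' * M * T') * p by
          noncomm_ring, hρM, trace_mul_comm (p * ρ), ← Matrix.mul_assoc, hpp]
    rw [h1, trace_re_eq_sum]
    refine Finset.sum_congr rfl fun k _ => ?_
    have h2 : (X * U)ᴴ * M * (X * U) = diagonal (fun i => ((√(g i) : ℝ) : ℂ)) * (Wᴴ * M * W)
        * diagonal (fun i => ((√(g i) : ℝ) : ℂ)) := by
      have : (diagonal (fun i => ((√(g i) : ℝ) : ℂ)))ᴴ = diagonal (fun i => ((√(g i) : ℝ) : ℂ)) := by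
        rw [diagonal_conjTranspose]; congr 1; ext i; simp
      rw [hXU, conjTranspose_mul, this]; noncomm_ring
    rw [h2, mul_diagonal, diagonal_mul, mul_right_comm, ← Complex.ofReal_mul,
      Real.mul_self_sqrt (hg k), Complex.re_ofReal_mul, mul_comm]
  have hH := Real.inner_le_Lp_mul_Lq_of_nonneg Finset.univ hconj
    (f := fun k => ((Wᴴ * M * W) k k).re) (g := g) (fun k _ => hm0 k) (fun k _ => hg k)
  rw [← htr] at hH
  have hQ0 : 0 ≤ ∑ k, ((Wᴴ * M * W) k k).re ^ β :=
    Finset.sum_nonneg fun k _ => Real.rpow_nonneg (hm0 k) _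
  have hG0 : 0 ≤ ∑ k, g k ^ γ := Finset.sum_nonneg fun k _ => Real.rpow_nonneg (hg k) _
  have htr0 : 0 ≤ (p * ρ).trace.re :=
    trace_mul_re_nonneg (posSemidef_of_isHermitian_of_mul_self hp hpp) hρ
  calc (p * ρ).trace.re ^ β
      ≤ ((∑ k, ((Wᴴ * M * W) k k).re ^ β) ^ (1 / β) * (∑ k, g k ^ γ) ^ (1 / γ)) ^ β :=
        Real.rpow_le_rpow htr0 hH (by linarith)
    _ = (∑ k, ((Wᴴ * M * W) k k).re ^ β) * (∑ k, g k ^ γ) ^ (β - 1) := by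
        rw [Real.mul_rpow (Real.rpow_nonneg hQ0 _) (Real.rpow_nonneg hG0 _), ← Real.rpow_mul hQ0,
          ← Real.rpow_mul hG0, one_div_mul_cancel (by linarith), Real.rpow_one]
        congr 2
        rw [hγ]
        field_simp
    _ ≤ Q β ρ τ * (p * τ).trace.re ^ (β - 1) :=
        mul_le_mul hmsum (Real.rpow_le_rpow hG0 hgsum hβ1.le) (Real.rpow_nonneg hG0 _)
          (hQ0.trans hmsum)

/-! ### Smoothing -/

/-- Smoothing of `V Vᴴ` on the range of `p` to an operator `W Wᴴ` below `S`. -/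
lemma exists_smoothing {V p S : Matrix n n ℂ} (hp : p.IsHermitian) (hpp : p * p = p)
    (hS : S.PosSemidef) (hpS : p * S = S) {δ : ℝ}
    (hδ : (posPart (p * (V * Vᴴ) * p - S)).trace.re ≤ δ) :
    ∃ W : Matrix n n ℂ, (S - W * Wᴴ).PosSemidef ∧ hsSq (p * V - W) ≤ δ ∧
      hsSq (V - W) = hsSq V - hsSq (p * V) + hsSq (p * V - W) ∧
      hsSq W ≤ hsSq (p * V) ∧ hsSq (p * V) - hsSq W ≤ δ := by
  have hpV : p * (V * Vᴴ) * p = (p * V) * (p * V)ᴴ := by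
    rw [conjTranspose_mul, hp.eq]; noncomm_ring
  rw [hpV] at hδ
  set Δ := posPart ((p * V) * (p * V)ᴴ - S) with hΔ
  have hh : ((p * V) * (p * V)ᴴ - S).IsHermitian :=
    (isHermitian_mul_conjTranspose_self _).sub hS.isHermitian
  have hΔ0 : Δ.PosSemidef := posSemidef_posPart hh
  -- Here `X = √(S + Δ)` and `Y = √S`. Since `p V (p V)ᴴ ≤ S + Δ`, Douglas gives `p V = X G`, and
  -- the witness is `W = Y G`: it lies below `S`, at squared distance at most `‖X - Y‖² ≤ Tr Δ`.
  obtain ⟨X, hX, hXX⟩ := exists_posSemidef_mul_self (hS.add hΔ0)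
  obtain ⟨Y, hY, hYY⟩ := exists_posSemidef_mul_self hS
  have hXV : (X * X - (p * V) * (p * V)ᴴ).PosSemidef := by
    rw [hXX]
    convert posSemidef_posPart_sub hh using 1
    rw [← hΔ]; abel
  obtain ⟨G, hXG, hG⟩ := exists_contraction hX hXV
  have hXY : X * X - Y * Y = Δ := by rw [hXX, hYY]; abel
  have hpY : p * Y = Y := by
    have h0 : ((1 - p) * Y) * ((1 - p) * Y)ᴴ = 0 := by
      rw [conjTranspose_mul, hY.isHermitian.eq, show (1 - p) * Y * (Y * (1 - p)ᴴ)
        = (Y * Y - p * (Y * Y)) * (1 - p)ᴴ by noncomm_ring, hYY, hpS]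
      simp
    have h1 := self_mul_conjTranspose_eq_zero.1 h0
    rw [sub_mul, Matrix.one_mul, sub_eq_zero] at h1
    exact h1.symm
  have hdiff : hsSq (p * V) - hsSq (Y * G) = (Δ * (G * Gᴴ)).trace.re := by
    have h1 : ∀ Z : Matrix n n ℂ, Z.PosSemidef →
        hsSq (Z * G) = (Z * Z * (G * Gᴴ)).trace.re := by
      intro Z hZ
      rw [hsSq, conjTranspose_mul, hZ.isHermitian.eq, trace_mul_comm,
        show Gᴴ * Z * (Z * G) = Gᴴ * (Z * Z * G) by noncomm_ring, trace_mul_comm]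
      congr 2
      noncomm_ring
    rw [← hXG, h1 X hX, h1 Y hY, ← hXY, sub_mul, trace_sub, Complex.sub_re]
  refine ⟨Y * G, ?_, ?_, ?_, ?_, ?_⟩
  · convert hG.mul_mul_conjTranspose_same Y using 1
    rw [← hYY, conjTranspose_mul, hY.isHermitian.eq]
    noncomm_ring
  · rw [← hXG, ← sub_mul]
    refine (hsSq_mul_le hG).trans ((hsSq_le_trace_sub hX hY ?_).trans ?_)
    · rw [hXY]; exact hΔ0
    · rw [hXY]; exact hδ
  -- Pythagoras, as `p` fixes `Y G`.
  · have horth : ∀ Z : Matrix n n ℂ, hsSq ((1 - p) * V + p * Z)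
        = hsSq ((1 - p) * V) + hsSq (p * Z) := by
      intro Z
      rw [hsSq_add]
      have : (1 - p) * V * (p * Z)ᴴ = (1 - p) * (V * Zᴴ) * p := by
        rw [conjTranspose_mul, hp.eq]; noncomm_ring
      rw [this, trace_mul_comm, ← Matrix.mul_assoc, mul_sub, hpp]
      simp
    have h1 := horth V
    have h2 := horth (V - Y * G)
    rw [show (1 - p) * V + p * V = V by noncomm_ring] at h1
    rw [show p * (V - Y * G) = p * V - (p * Y) * G by noncomm_ring, hpY,
      show (1 - p) * V + (p * V - Y * G) = V - Y * G by noncomm_ring] at h2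
    linarith
  · have := trace_mul_re_nonneg hΔ0 (posSemidef_self_mul_conjTranspose G)
    linarith
  · have := trace_mul_re_le_right hΔ0 hG
    rw [Matrix.mul_one] at this
    linarith

end matrices

/-! ### Marginals -/

variable {A B : Type*} [Fintype A] [DecidableEq A] [Fintype B] [DecidableEq B]

lemma trace_marginalA (X : Matrix (A × B) (A × B) ℂ) : (marginalA X).trace = X.trace := by
  simp [Matrix.trace, marginalA, Fintype.sum_prod_type]

lemma marginalA_add (X Y : Matrix (A × B) (A × B) ℂ) :
    marginalA (X + Y) = marginalA X + marginalA Y := by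
  ext i j
  simp [marginalA, Finset.sum_add_distrib]

lemma marginalA_sub (X Y : Matrix (A × B) (A × B) ℂ) :
    marginalA (X - Y) = marginalA X - marginalA Y := by
  ext i j
  simp [marginalA, Finset.sum_sub_distrib]

lemma marginalA_smul (r : ℝ) (X : Matrix (A × B) (A × B) ℂ) :
    marginalA (r • X) = r • marginalA X := by
  ext i j
  simp [marginalA, Finset.mul_sum]

lemma marginalA_kronecker (X : Matrix A A ℂ) (Y : Matrix B B ℂ) :
    marginalA (X ⊗ₖ Y) = Y.trace • X := by
  ext i j
  simp [marginalA, Matrix.trace, ← Finset.mul_sum, mul_comm]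

lemma marginalA_kronecker_one_mul (a : Matrix A A ℂ) (X : Matrix (A × B) (A × B) ℂ) :
    marginalA ((a ⊗ₖ (1 : Matrix B B ℂ)) * X) = a * marginalA X := by
  ext i j
  simp only [marginalA, Matrix.mul_apply, kroneckerMap_apply, Fintype.sum_prod_type, one_apply,
    mul_ite, mul_one, mul_zero, ite_mul, zero_mul, Finset.sum_ite_eq, Finset.mem_univ, if_true,
    Finset.mul_sum]
  rw [Finset.sum_comm]

lemma marginalA_mul_kronecker_one (a : Matrix A A ℂ) (X : Matrix (A × B) (A × B) ℂ) :
    marginalA (X * (a ⊗ₖ (1 : Matrix B B ℂ))) = marginalA X * a := by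
  ext i j
  simp only [marginalA, Matrix.mul_apply, kroneckerMap_apply, Fintype.sum_prod_type, one_apply,
    mul_ite, mul_one, mul_zero, Finset.sum_ite_eq', Finset.mem_univ, if_true, Finset.sum_mul]
  rw [Finset.sum_comm]

lemma posSemidef_marginalA {X : Matrix (A × B) (A × B) ℂ} (hX : X.PosSemidef) :
    (marginalA X).PosSemidef := by
  have : marginalA X = ∑ b, X.submatrix (fun a => (a, b)) (fun a => (a, b)) := by
    ext i j
    simp [marginalA, Matrix.sum_apply]
  rw [this]
  exact posSemidef_sum _ fun b _ => hX.submatrix _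

lemma trace_kronecker_one_mul (a : Matrix A A ℂ) (X : Matrix (A × B) (A × B) ℂ) :
    ((a ⊗ₖ (1 : Matrix B B ℂ)) * X).trace = (a * marginalA X).trace := by
  rw [← trace_marginalA, marginalA_kronecker_one_mul]

lemma isHermitian_kronecker_one {a : Matrix A A ℂ} (ha : a.IsHermitian) :
    (a ⊗ₖ (1 : Matrix B B ℂ)).IsHermitian := by
  rw [IsHermitian, conjTranspose_kronecker, ha.eq, conjTranspose_one]

lemma kronecker_one_mul_self {a : Matrix A A ℂ} (ha : a * a = a) :
    (a ⊗ₖ (1 : Matrix B B ℂ)) * (a ⊗ₖ (1 : Matrix B B ℂ)) = a ⊗ₖ (1 : Matrix B B ℂ) := by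
  rw [← mul_kronecker_mul, ha, Matrix.one_mul]

lemma kronecker_one_mul_kronecker (a b : Matrix A A ℂ) (σ : Matrix B B ℂ) :
    (a ⊗ₖ (1 : Matrix B B ℂ)) * (b ⊗ₖ σ) = (a * b) ⊗ₖ σ := by
  rw [← mul_kronecker_mul, Matrix.one_mul]

/-! ### The smoothed state -/

lemma posSemidef_real_smul {n : Type*} [Fintype n] {M : Matrix n n ℂ} (hM : M.PosSemidef)
    {r : ℝ} (hr : 0 ≤ r) : (r • M).PosSemidef :=
  hM.smul hr

/-- Numerical estimate for the distance when mass has been removed. -/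
lemma half_add_sqrt_le {ε x q D S : ℝ} (hε : 0 < ε) (hε1 : ε ≤ 1) (hx0 : 0 ≤ x)
    (hx : x ≤ 0.268 * ε ^ 2) (hq : 1 - q ≤ 2 * x + x ^ 2) (hD : D ≤ 2 * x + x ^ 2)
    (hD0 : 0 ≤ D) (hS0 : 0 ≤ S) (hS : S = 2 * 1 + 2 * q - D) :
    (1 - q) / 2 + √D * √S / 2 ≤ ε := by
  have h1 : √D ^ 2 = D := Real.sq_sqrt hD0
  have h2 : √S ^ 2 = S := Real.sq_sqrt hS0
  have hx2 : 2 * x + x ^ 2 ≤ 0.608 * ε ^ 2 := by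
    have : x ≤ 0.268 := by nlinarith
    nlinarith
  -- The weights nearly balance the two terms at the extreme values `D = 0.608 ε²` and `S = 4`.
  have h3 : 20 * ε * (√D * √S) ≤ 25 * D + 4 * ε ^ 2 * S := by
    nlinarith [sq_nonneg (5 * √D - 2 * ε * √S)]
  have h4 : (1 - q) * (ε * (20 - 8 * ε)) ≤ 0.608 * ε ^ 2 * (ε * (20 - 8 * ε)) :=
    mul_le_mul_of_nonneg_right (hq.trans hx2) (mul_nonneg hε.le (by linarith))
  -- The maximum of this parabola, at `ε = 5/4`.
  have h5 : ε * (20 - 8 * ε) ≤ 12.5 := by nlinarith [sq_nonneg (ε - 1)]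
  have h6 : 0.608 * ε ^ 2 * (ε * (20 - 8 * ε)) ≤ 0.608 * ε ^ 2 * 12.5 :=
    mul_le_mul_of_nonneg_left h5 (by positivity)
  have h7 : 0 ≤ ε ^ 2 * D := by positivity
  have h8 : 20 * ε * ((1 - q) + √D * √S) ≤ 20 * ε * (2 * ε) := by
    subst hS
    nlinarith
  have := le_of_mul_le_mul_left h8 (by positivity)
  linarith

/-- Numerical estimate for the distance when mass has been added. -/
lemma sqrt_add_le {ε x t D : ℝ} (hε : 0 < ε) (hε1 : ε ≤ 1) (hx0 : 0 ≤ x)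
    (hx : x ≤ 0.268 * ε ^ 2) (ht : t ≤ x + x ^ 2 / 2) (hD : D ≤ t + x ^ 2) :
    √D + t ≤ ε := by
  have hx3 : x ≤ 0.268 := by nlinarith
  have h1 : t ≤ 0.304 * ε ^ 2 := by nlinarith
  have h2 : D ≤ (0.62 * ε) ^ 2 := by nlinarith
  have h3 : √D ≤ 0.62 * ε := Real.sqrt_le_iff.2 ⟨by positivity, h2⟩
  nlinarith

/-- A state near `ρ` whose max mutual information is controlled: `P` cuts the marginal to its
eigenvalues above `m`, and `posPart` measures the part of the cut state above `l P ⊗ σ`. -/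
lemma exists_density_near {ρ : Matrix (A × B) (A × B) ℂ} (hρ : IsDensity ρ) {σ : Matrix B B ℂ}
    (hσ : IsDensity σ) {P : Matrix A A ℂ} (hP : P.IsHermitian) (hPP : P * P = P)
    {ε x l m t : ℝ} (hε : 0 < ε) (hε1 : ε ≤ 1) (hx0 : 0 ≤ x) (hx : x ≤ 0.268 * ε ^ 2)
    (hm : 0 < m) (hl : 0 ≤ l) (ht : l / m + 1 ≤ t)
    (hPm : (P * marginalA ρ * P - m • P).PosSemidef)
    (hPρ : 1 - (P * marginalA ρ).trace.re ≤ 2 * x)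
    (hδ : (posPart ((P ⊗ₖ (1 : Matrix B B ℂ)) * ρ * (P ⊗ₖ (1 : Matrix B B ℂ))
      - l • (P ⊗ₖ σ))).trace.re ≤ x ^ 2) :
    ∃ ρ' ∈ ball ε ρ, (t • (marginalA ρ' ⊗ₖ σ) - ρ').PosSemidef := by
  set p : Matrix (A × B) (A × B) ℂ := P ⊗ₖ (1 : Matrix B B ℂ) with hp
  have hph : p.IsHermitian := isHermitian_kronecker_one hP
  have hpp : p * p = p := kronecker_one_mul_self hPP
  have hPpos := posSemidef_of_isHermitian_of_mul_self hP hPP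
  obtain ⟨V, hV, hVV⟩ := exists_posSemidef_mul_self hρ.1
  have hVV' : V * Vᴴ = ρ := by rw [hV.isHermitian.eq, hVV]
  have hS : (l • (P ⊗ₖ σ)).PosSemidef := posSemidef_real_smul (hPpos.kronecker hσ.1) hl
  have hpS : p * (l • (P ⊗ₖ σ)) = l • (P ⊗ₖ σ) := by
    rw [mul_smul_comm, hp, kronecker_one_mul_kronecker, hPP]
  obtain ⟨W, hWS, hd', hd, hW1, hW2⟩ := exists_smoothing (V := V) (δ := x ^ 2) hph hpp hS hpS
    (by rw [hVV']; exact hδ)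
  have hV1 : hsSq V = 1 := by rw [hsSq, hVV', hρ.2]; simp
  have hpV1 : hsSq (p * V) = (P * marginalA ρ).trace.re := by
    rw [← trace_kronecker_one_mul, hsSq, conjTranspose_mul, hph.eq,
      show p * V * (Vᴴ * p) = p * (V * Vᴴ) * p by noncomm_ring, hVV', trace_mul_comm,
      ← Matrix.mul_assoc, hpp]
  have hpV2 : (p * V) * (p * V)ᴴ = p * ρ * p := by
    rw [conjTranspose_mul, hph.eq, ← hVV']; noncomm_ring
  have hWW := posSemidef_self_mul_conjTranspose W
  have hWA := posSemidef_marginalA hWW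
  have hρA : marginalA (p * ρ * p) = P * marginalA ρ * P := by
    rw [hp, marginalA_mul_kronecker_one, marginalA_kronecker_one_mul]
  set K : Matrix A A ℂ := P * marginalA ρ * P - marginalA (W * Wᴴ) with hK
  have hKm : K = marginalA ((p * V) * (p * V)ᴴ - W * Wᴴ) := by
    rw [marginalA_sub, hpV2, hρA]
  have hKh : K.IsHermitian := by
    have := (posSemidef_marginalA hρ.1).mul_mul_conjTranspose_same P
    rw [hP.eq] at this
    exact this.isHermitian.sub hWA.isHermitian
  -- `X` restores what smoothing removed from the marginal: `marginalA (W * Wᴴ) + X ≥ P * marginalA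
  -- ρ * P`.
  set X : Matrix A A ℂ := posPart K with hX
  have hX0 : X.PosSemidef := posSemidef_posPart hKh
  have hD'0 := hsSq_nonneg (p * V - W)
  have hD0 := hsSq_nonneg (V - W)
  have hsum : ∀ Z : Matrix (A × B) (A × B) ℂ,
      hsSq (Z + W) = 2 * hsSq Z + 2 * hsSq W - hsSq (Z - W) := by
    intro Z; rw [hsSq_add, hsSq_sub]; ring
  have hpV3 : hsSq (p * V) ≤ 1 := by
    have h1 := trace_re_nonneg (hρ.1.mul_mul_conjTranspose_same (1 - p))
    have h2 : ((1 - p) * ρ * (1 - p)ᴴ).trace = ((1 - p) * ρ).trace := by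
      rw [(isHermitian_one.sub hph).eq, trace_mul_comm, ← Matrix.mul_assoc,
        show (1 - p) * (1 - p) = 1 - p by rw [sub_mul, mul_sub, mul_sub, hpp]; simp]
    rw [h2, sub_mul, Matrix.one_mul, trace_sub, hρ.2, hp, trace_kronecker_one_mul,
      Complex.sub_re, ← hpV1] at h1
    simpa using h1
  have hW0 := hsSq_nonneg W
  -- the mass of the correction
  have hXt : X.trace.re ≤ x + x ^ 2 / 2 := by
    have h1 := trace_proj_mul_sub_re_le (p := posProj K ⊗ₖ (1 : Matrix B B ℂ)) (V := p * V)
      (W := W) (isHermitian_kronecker_one (isHermitian_posProj K))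
      (kronecker_one_mul_self (posProj_mul_self hKh))
    rw [trace_kronecker_one_mul, ← hKm, ← posPart_eq hKh, ← hX] at h1
    have h2 : √(hsSq (p * V - W)) ≤ x := Real.sqrt_le_iff.2 ⟨hx0, hd'⟩
    have h3 : √(hsSq (p * V + W)) ≤ 2 := by
      refine Real.sqrt_le_iff.2 ⟨by norm_num, ?_⟩
      rw [hsum]; linarith
    have h4 : √(hsSq (p * V - W)) * √(hsSq (p * V + W)) ≤ x * 2 :=
      mul_le_mul h2 h3 (Real.sqrt_nonneg _) hx0
    linarith
  have hXt0 := trace_re_nonneg hX0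
  set R : Matrix (A × B) (A × B) ℂ := W * Wᴴ + X ⊗ₖ σ with hR
  have hXσ : (X ⊗ₖ σ).PosSemidef := hX0.kronecker hσ.1
  have hR0 : R.PosSemidef := hWW.add hXσ
  have hRA : marginalA R = marginalA (W * Wᴴ) + X := by
    rw [hR, marginalA_add, marginalA_kronecker, hσ.2, one_smul]
  set N : ℝ := R.trace.re with hN
  have hNval : N = hsSq W + X.trace.re := by
    rw [hN, hR, trace_add, trace_kronecker, hσ.2, mul_one, Complex.add_re, hsSq]
  have hRN : R.trace = (N : ℂ) := by
    apply Complex.ext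
    · simp [hN]
    · simp [trace_im_eq_zero hR0.isHermitian]
  have hx2 : 2 * x + x ^ 2 < 1 := by
    have : x ≤ 0.268 := by nlinarith
    nlinarith
  have hN0 : 0 < N := by rw [hNval]; linarith
  have hRt : (t • (marginalA R ⊗ₖ σ) - R).PosSemidef := by
    have h1 : (marginalA R - m • P).PosSemidef := by
      have h := (posSemidef_posPart_sub hKh).add hPm
      rw [← hX, hK] at h
      convert h using 1
      rw [hRA]; abel
    have h2 : (marginalA R).PosSemidef := by rw [hRA]; exact hWA.add hX0
    -- Each of the four summands is positive semidefinite; the third one expresses `X ≤ marginalA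
    -- R`.
    have e : t • (marginalA R ⊗ₖ σ) - R = (t - (l / m + 1)) • (marginalA R ⊗ₖ σ)
        + (l / m) • ((marginalA R - m • P) ⊗ₖ σ) + marginalA (W * Wᴴ) ⊗ₖ σ
        + (l • (P ⊗ₖ σ) - W * Wᴴ) := by
      have e1 : (marginalA R - m • P) ⊗ₖ σ = marginalA R ⊗ₖ σ - m • (P ⊗ₖ σ) := by
        ext ⟨i, k⟩ ⟨j, k'⟩
        simp [sub_mul, mul_assoc]
      have e2 : marginalA (W * Wᴴ) ⊗ₖ σ = marginalA R ⊗ₖ σ - X ⊗ₖ σ := by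
        rw [hRA, add_kronecker]; abel
      rw [e1, e2, hR, smul_sub, smul_smul, div_mul_cancel₀ _ hm.ne', sub_smul, add_smul, one_smul]
      abel
    rw [e]
    exact (((posSemidef_real_smul (h2.kronecker hσ.1) (by linarith)).add
      (posSemidef_real_smul (h1.kronecker hσ.1) (by positivity))).add
      (hWA.kronecker hσ.1)).add hWS
  have hNR : (N⁻¹ • R).trace = 1 := by
    rw [trace_smul, hRN, Complex.real_smul, ← Complex.ofReal_mul, inv_mul_cancel₀ hN0.ne']
    simp
  have hNRp : (N⁻¹ • R).PosSemidef := posSemidef_real_smul hR0 (inv_nonneg.2 hN0.le)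
  refine ⟨N⁻¹ • R, ⟨⟨hNRp, hNR⟩, ?_⟩, ?_⟩
  -- Normalization enlarges `R` if `N ≤ 1` and shrinks it if `N > 1`. Testing `ρ - ρ'` in the first
  -- case and `ρ' - ρ` in the second allows it to be discarded.
  · rcases le_or_gt N 1 with h1 | h1
    · refine half_traceNorm_sub_le hρ.1.isHermitian hNRp.isHermitian (by rw [hρ.2, hNR]) ?_
      intro e he hee
      have hepos := posSemidef_of_isHermitian_of_mul_self he hee
      have hge : ((ρ - W * Wᴴ) - (ρ - N⁻¹ • R)).PosSemidef := by
        have : (ρ - W * Wᴴ) - (ρ - N⁻¹ • R) = (N⁻¹ - 1) • R + X ⊗ₖ σ := by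
          rw [sub_smul, one_smul, hR]; abel
        rw [this]
        exact (posSemidef_real_smul hR0 (sub_nonneg.2 ((one_le_inv₀ hN0).2 h1))).add hXσ
      refine (trace_mul_re_le_right hepos hge).trans ?_
      have h2 := trace_proj_mul_sub_re_le (V := V) (W := W) he hee
      rw [hVV', hV1] at h2
      refine h2.trans (half_add_sqrt_le hε hε1 hx0 hx ?_ ?_ hD0 (hsSq_nonneg _) ?_)
      · linarith
      · linarith
      · rw [hsum, hV1]
    · refine half_traceNorm_sub_le' hρ.1.isHermitian hNRp.isHermitian (by rw [hρ.2, hNR]) ?_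
      intro e he hee
      have hepos := posSemidef_of_isHermitian_of_mul_self he hee
      have hge : ((R - ρ) - (N⁻¹ • R - ρ)).PosSemidef := by
        have : (R - ρ) - (N⁻¹ • R - ρ) = (1 - N⁻¹) • R := by
          rw [sub_smul, one_smul]; abel
        rw [this]
        exact posSemidef_real_smul hR0 (sub_nonneg.2 (inv_le_one_of_one_le₀ h1.le))
      refine (trace_mul_re_le_right hepos hge).trans ?_
      have h2 := trace_proj_mul_sub_re_le (V := W) (W := V) he hee
      rw [hVV', hV1] at h2
      have h3 : (e * (X ⊗ₖ σ)).trace.re ≤ X.trace.re := by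
        have h4 : (1 - e).PosSemidef := posSemidef_of_isHermitian_of_mul_self
          (isHermitian_one.sub he) (by rw [sub_mul, mul_sub, mul_sub, hee]; simp)
        have h5 := trace_mul_re_nonneg h4 hXσ
        rw [sub_mul, Matrix.one_mul, trace_sub, Complex.sub_re, trace_kronecker, hσ.2,
          mul_one] at h5
        linarith
      have hsymm : hsSq (W - V) = hsSq (V - W) := by
        rw [hsSq_sub, hsSq_sub, trace_mul_conjTranspose_re_comm]; ring
      have h6 : √(hsSq (W + V)) ≤ 2 := by
        refine Real.sqrt_le_iff.2 ⟨by norm_num, ?_⟩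
        rw [add_comm, hsum, hV1]; linarith
      have h7 : √(hsSq (W - V)) * √(hsSq (W + V)) ≤ √(hsSq (V - W)) * 2 := by
        rw [hsymm]; exact mul_le_mul_of_nonneg_left h6 (Real.sqrt_nonneg _)
      -- From `N > 1` and `hsSq W ≤ hsSq (p * V)`, the mass cut off by `p` is less than `Tr X`, a
      -- better bound here than `2x`.
      have h8 := sqrt_add_le (D := hsSq (V - W)) hε hε1 hx0 hx hXt (by
        rw [hNval] at h1; linarith)
      rw [show e * (R - ρ) = e * (W * Wᴴ - ρ) + e * (X ⊗ₖ σ) by rw [hR]; noncomm_ring,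
        trace_add, Complex.add_re]
      linarith
  · have := posSemidef_real_smul hRt (inv_nonneg.2 hN0.le)
    convert this using 1
    rw [marginalA_smul, smul_sub, smul_kronecker, smul_smul, smul_smul, mul_comm]

/-! ### Choice of the cut-offs -/

/-- The projection onto the eigenspaces with eigenvalue at least `m`. -/
def cutProj {n : Type*} [Fintype n] [DecidableEq n] (m : ℝ) (M : Matrix n n ℂ) : Matrix n n ℂ :=
  cfc (fun x : ℝ => if m ≤ x then 1 else 0) M

section cutProj

variable {n : Type*} [Fintype n] [DecidableEq n] {M : Matrix n n ℂ}

lemma isHermitian_cutProj (m : ℝ) : (cutProj m M).IsHermitian := isHermitian_cfc _ _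

lemma cutProj_mul_self (hM : M.IsHermitian) (m : ℝ) :
    cutProj m M * cutProj m M = cutProj m M := by
  rw [cutProj, cfc_mul_cfc hM]
  congr 1
  ext x
  split_ifs <;> simp

lemma posSemidef_cutProj_mul_mul_sub (hM : M.IsHermitian) (m : ℝ) :
    (cutProj m M * M * cutProj m M - m • cutProj m M).PosSemidef := by
  rw [cutProj, cfc_mul_self_right hM, cfc_mul_cfc hM, cfc_real_smul hM, cfc_sub_cfc hM]
  refine posSemidef_cfc hM fun x => ?_
  split_ifs with h
  · simpa using h
  · simp

/-- An eigenvalue `x` below `m` satisfies `x = x^(1-α) x^α ≤ m^(1-α) x^α`. -/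
lemma trace_cutProj_mul_ge (hM : M.PosSemidef) {m α : ℝ} (hm : 0 ≤ m) (hα : α ∈ Set.Ioo (0 : ℝ) 1) :
    M.trace.re - (cutProj m M * M).trace.re ≤ m ^ (1 - α) * (mpow M α).trace.re := by
  have hMh := hM.isHermitian
  have h : (m ^ (1 - α) • mpow M α - (M - cutProj m M * M)).PosSemidef := by
    have e : M - cutProj m M * M = cfc (fun x : ℝ => x - (if m ≤ x then 1 else 0) * x) M := by
      rw [cutProj, cfc_mul_self_right hMh, ← cfc_sub_cfc hMh, cfc_self hMh]
    rw [e, mpow, cfc_real_smul hMh, cfc_sub_cfc hMh]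
    refine posSemidef_cfc_of_nonneg hM fun x hx => ?_
    split_ifs with h
    · simp only [one_mul, sub_self, sub_zero]
      exact mul_nonneg (Real.rpow_nonneg hm _) (Real.rpow_nonneg hx _)
    · have h1 : x ^ (1 - α) * x ^ α = x := by
        rw [← Real.rpow_add' hx (by simp)]; simp
      have h2 : x ^ (1 - α) ≤ m ^ (1 - α) :=
        Real.rpow_le_rpow hx (not_le.1 h).le (by linarith [hα.2])
      have h3 := mul_le_mul_of_nonneg_right h2 (Real.rpow_nonneg hx α)
      linarith
  have := trace_re_le h
  rwa [trace_sub, Complex.sub_re, trace_smul, Complex.smul_re, smul_eq_mul] at this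

lemma trace_mpow_pos (hM : IsDensity M) {α : ℝ} : 0 < (mpow M α).trace.re := by
  obtain ⟨U, d, hU, -, hf, hd, hd0⟩ := exists_spectral hM.1.isHermitian
  have hd0 := hd0 hM.1
  have h1 : (mpow M α).trace.re = ∑ i, d i ^ α := by
    rw [mpow, hf, trace_mul_comm, ← Matrix.mul_assoc, hU, Matrix.one_mul, trace_diagonal,
      Complex.re_sum]
    simp only [Complex.ofReal_re]
  have h2 : ∑ i, d i = 1 := by
    have := congrArg Complex.re hM.2
    rw [hd, trace_mul_comm, ← Matrix.mul_assoc, hU, Matrix.one_mul, trace_diagonal,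
      Complex.re_sum] at this
    simpa using this
  obtain ⟨i, hi⟩ : ∃ i, 0 < d i := by
    by_contra! hcon
    have := Finset.sum_nonpos fun i (_ : i ∈ Finset.univ) => hcon i
    linarith
  rw [h1]
  exact Finset.sum_pos' (fun j _ => Real.rpow_nonneg (hd0 j) _)
    ⟨i, Finset.mem_univ i, Real.rpow_pos_of_pos hi _⟩

end cutProj

/-! ### The bound for a fixed `σ`. -/

lemma isDensity_marginalA {ρ : Matrix (A × B) (A × B) ℂ} (hρ : IsDensity ρ) :
    IsDensity (marginalA ρ) :=
  ⟨posSemidef_marginalA hρ.1, by rw [trace_marginalA, hρ.2]⟩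

lemma smoothImax_le_logb {ε t : ℝ} {ρ ρ' : Matrix (A × B) (A × B) ℂ} {σ : Matrix B B ℂ}
    (hρ' : ρ' ∈ ball ε ρ) (hσ : IsDensity σ) (ht : 0 < t)
    (h : (t • (marginalA ρ' ⊗ₖ σ) - ρ').PosSemidef) :
    smoothImax ε ρ ≤ ((Real.logb 2 t : ℝ) : EReal) :=
  (iInf₂_le ρ' hρ').trans ((iInf₂_le σ hσ).trans (iInf₂_le t ⟨ht, h⟩))

lemma smoothImax_le_of_suppLE {ε α β : ℝ} (hε : ε ∈ Set.Ioo (0 : ℝ) 1)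
    (hα : α ∈ Set.Ioo (0 : ℝ) 1) (hβ : 1 < β) {ρ : Matrix (A × B) (A × B) ℂ} (hρ : IsDensity ρ)
    {σ : Matrix B B ℂ} (hσ : IsDensity σ) (hs : SuppLE ρ ((1 : Matrix A A ℂ) ⊗ₖ σ)) :
    smoothImax ε ρ ≤ ((renyiEntropy α (marginalA ρ)
      + 1 / (β - 1) * Real.logb 2 (Q β ρ ((1 : Matrix A A ℂ) ⊗ₖ σ)) + corr α β ε : ℝ) : EReal) := by
  obtain ⟨hε0, hε1⟩ := hε
  obtain ⟨hα0, hα1⟩ := hα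
  have hβ1 : 0 < β - 1 := by linarith
  have hα1' : 0 < 1 - α := by linarith
  set τ : Matrix (A × B) (A × B) ℂ := (1 : Matrix A A ℂ) ⊗ₖ σ with hτ
  have hτ0 : τ.PosSemidef := PosSemidef.one.kronecker hσ.1
  set q := Q β ρ τ with hq
  have hρA := isDensity_marginalA hρ
  have htest : ∀ p : Matrix (A × B) (A × B) ℂ, p.IsHermitian → p * p = p →
      (p * ρ).trace.re ^ β ≤ q * (p * τ).trace.re ^ (β - 1) :=
    fun p hp hpp => trace_proj_rpow_le hβ hρ.1 hτ0 hs hp hpp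
  have hq0 : 0 < q := by
    have h1 := htest 1 isHermitian_one (Matrix.one_mul 1)
    rw [Matrix.one_mul, Matrix.one_mul, hρ.2, Complex.one_re, Real.one_rpow] at h1
    by_contra hcon
    have := mul_nonpos_of_nonpos_of_nonneg (not_lt.1 hcon)
      (Real.rpow_nonneg (trace_re_nonneg hτ0) (β - 1))
    linarith
  set T := (mpow (marginalA ρ) α).trace.re with hT
  have hT0 : 0 < T := trace_mpow_pos hρA
  set x : ℝ := (2 - √3) * ε ^ 2 with hx
  have h3 : √3 < 2 := (Real.sqrt_lt' (by norm_num)).2 (by norm_num)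
  -- The distance estimates use the constant `2 - √3` only through `2 - √3 < 0.268`.
  have h3' : 1.732 < √3 := Real.lt_sqrt_of_sq_lt (by norm_num)
  have hx0 : 0 < x := mul_pos (by linarith) (by positivity)
  have hxε : x ≤ 0.268 * ε ^ 2 := mul_le_mul_of_nonneg_right (by linarith) (by positivity)
  have hx1 : x ≤ 0.268 := by nlinarith
  set l : ℝ := (q / x ^ 2) ^ (1 / (β - 1)) with hl
  set m : ℝ := (2 * x / T) ^ (1 / (1 - α)) with hm
  have hl0 : 0 < l := Real.rpow_pos_of_pos (by positivity) _
  have hm0 : 0 < m := Real.rpow_pos_of_pos (by positivity) _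
  have hlβ : x ^ 2 * l ^ (β - 1) = q := by
    rw [hl, one_div, Real.rpow_inv_rpow (by positivity) hβ1.ne']
    field_simp
  have hmα : m ^ (1 - α) * T = 2 * x := by
    rw [hm, one_div, Real.rpow_inv_rpow (by positivity) hα1'.ne']
    field_simp
  set P := cutProj m (marginalA ρ) with hP
  have hPh : P.IsHermitian := isHermitian_cutProj m
  have hPP : P * P = P := cutProj_mul_self hρA.1.isHermitian m
  have hPm : (P * marginalA ρ * P - m • P).PosSemidef :=
    posSemidef_cutProj_mul_mul_sub hρA.1.isHermitian m
  have hPρ : 1 - (P * marginalA ρ).trace.re ≤ 2 * x := by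
    have := trace_cutProj_mul_ge hρA.1 hm0.le ⟨hα0, hα1⟩
    rwa [hρA.2, Complex.one_re, ← hT, hmα] at this
  set a := (P * marginalA ρ).trace.re with ha
  have hax : x ^ 2 ≤ a := by nlinarith
  have ha0 : 0 < a := lt_of_lt_of_le (by positivity) hax
  set p : Matrix (A × B) (A × B) ℂ := P ⊗ₖ (1 : Matrix B B ℂ) with hp
  have hph : p.IsHermitian := isHermitian_kronecker_one hPh
  have hpp : p * p = p := kronecker_one_mul_self hPP
  -- Testing with `P ⊗ 1` and using `m Tr P ≤ a` gives `a m^(β-1) ≤ q = x² l^(β-1)`, while `a ≥ x²`.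
  have hml : m ≤ l := by
    have h1 := htest p hph hpp
    have h2 : (p * τ).trace.re = P.trace.re := by
      rw [hp, hτ, kronecker_one_mul_kronecker, Matrix.mul_one, trace_kronecker, hσ.2, mul_one]
    rw [hp, trace_kronecker_one_mul, ← hp, h2, ← ha] at h1
    have h4 : m * P.trace.re ≤ a := by
      have := trace_re_le hPm
      rwa [trace_smul, Complex.smul_re, smul_eq_mul, trace_mul_comm, ← Matrix.mul_assoc, hPP,
        ← ha] at this
    have hPt : 0 ≤ P.trace.re := trace_re_nonneg (posSemidef_of_isHermitian_of_mul_self hPh hPP)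
    have h5 : a ^ β * m ^ (β - 1) ≤ q * a ^ (β - 1) :=
      calc a ^ β * m ^ (β - 1) ≤ q * P.trace.re ^ (β - 1) * m ^ (β - 1) :=
            mul_le_mul_of_nonneg_right h1 (Real.rpow_nonneg hm0.le _)
        _ = q * (m * P.trace.re) ^ (β - 1) := by
            rw [Real.mul_rpow hm0.le hPt]; ring
        _ ≤ q * a ^ (β - 1) := mul_le_mul_of_nonneg_left
            (Real.rpow_le_rpow (mul_nonneg hm0.le hPt) h4 hβ1.le) hq0.le
    have h6 : a ^ β = a * a ^ (β - 1) := by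
      rw [← Real.rpow_one_add' ha0.le (by linarith)]; ring_nf
    have h7 : a * m ^ (β - 1) ≤ q := by
      have hpos := Real.rpow_pos_of_pos ha0 (β - 1)
      refine le_of_mul_le_mul_right ?_ hpos
      rw [h6] at h5
      linarith
    have h8 : x ^ 2 * m ^ (β - 1) ≤ x ^ 2 * l ^ (β - 1) := by
      rw [hlβ]
      exact (mul_le_mul_of_nonneg_right hax (Real.rpow_nonneg hm0.le _)).trans h7
    have h9 := le_of_mul_le_mul_left h8 (by positivity)
    exact (Real.rpow_le_rpow_iff hm0.le hl0.le hβ1).1 h9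
  have hδ : (posPart (p * ρ * p - l • (P ⊗ₖ σ))).trace.re ≤ x ^ 2 := by
    set H := p * ρ * p - l • (P ⊗ₖ σ) with hH
    have hPσ : P ⊗ₖ σ = p * τ := by
      rw [hp, hτ, kronecker_one_mul_kronecker, Matrix.mul_one]
    have hPσ' : P ⊗ₖ σ * p = P ⊗ₖ σ := by
      rw [hp, ← mul_kronecker_mul, hPP, Matrix.mul_one]
    have hPpos := posSemidef_of_isHermitian_of_mul_self hPh hPP
    have hHh : H.IsHermitian := by
      have h1 := (hρ.1.mul_mul_conjTranspose_same p).isHermitian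
      rw [hph.eq] at h1
      exact h1.sub (posSemidef_real_smul (hPpos.kronecker hσ.1) hl0.le).isHermitian
    have hHp : H * p = H := by
      rw [hH, sub_mul, Matrix.mul_assoc, hpp, smul_mul_assoc, hPσ']
    set e := posProj H with he
    have heh : e.IsHermitian := isHermitian_posProj H
    have hee : e * e = e := posProj_mul_self hHh
    have hep : e * p = e := posProj_mul_of_mul_eq hHh hHp
    have hpe : p * e = e := by
      have := congrArg conjTranspose hep
      rwa [conjTranspose_mul, heh.eq, hph.eq] at this
    have h1 := htest e heh hee
    have h2 : (posPart H).trace.re = (e * ρ).trace.re - l * (e * τ).trace.re := by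
      rw [posPart_eq hHh, ← he, hH, mul_sub, mul_smul_comm, hPσ, ← Matrix.mul_assoc e p, hep,
        show e * (p * ρ * p) = (e * p) * ρ * p by noncomm_ring, hep, trace_sub, Complex.sub_re,
        trace_mul_comm, ← Matrix.mul_assoc, hpe, trace_smul, Complex.smul_re, smul_eq_mul]
    have h4 := trace_re_nonneg (posSemidef_posPart hHh)
    have hepos := posSemidef_of_isHermitian_of_mul_self heh hee
    have h5 := trace_mul_re_nonneg hepos hτ0
    set u := (e * ρ).trace.re
    set v := (e * τ).trace.re
    -- The positive part has trace `u - l v ≥ 0`, so `u^β ≤ q v^(β-1) = x² (l v)^(β-1) ≤ x²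
    -- u^(β-1)`.
    have hu : u ≤ x ^ 2 := by
      rcases (trace_mul_re_nonneg hepos hρ.1).eq_or_lt with h0 | h0
      · change (0 : ℝ) = u at h0
        rw [← h0]; positivity
      · change 0 < u at h0
        have h6 : u ^ β ≤ x ^ 2 * u ^ (β - 1) :=
          calc u ^ β ≤ q * v ^ (β - 1) := h1
            _ = x ^ 2 * (l * v) ^ (β - 1) := by rw [← hlβ, Real.mul_rpow hl0.le h5]; ring
            _ ≤ x ^ 2 * u ^ (β - 1) := mul_le_mul_of_nonneg_left
              (Real.rpow_le_rpow (mul_nonneg hl0.le h5) (by linarith) hβ1.le) (by positivity)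
        have h7 : u ^ β = u * u ^ (β - 1) := by
          rw [← Real.rpow_one_add' h0.le (by linarith)]; ring_nf
        rw [h7] at h6
        exact le_of_mul_le_mul_right h6 (Real.rpow_pos_of_pos h0 _)
    have := mul_nonneg hl0.le h5
    linarith
  have ht : l / m + 1 ≤ 2 * (l / m) := by
    have := (one_le_div hm0).2 hml
    linarith
  obtain ⟨ρ', hball, hρ'⟩ := exists_density_near hρ hσ hPh hPP hε0 hε1.le hx0.le hxε hm0 hl0.le ht
    hPm hPρ hδ
  refine (smoothImax_le_logb hball hσ (by positivity) hρ').trans (EReal.coe_le_coe_iff.2 ?_)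
  have hlogl : Real.logb 2 l = 1 / (β - 1) * (Real.logb 2 q - 2 * Real.logb 2 x) := by
    rw [hl, Real.logb_rpow_eq_mul_logb_of_pos (by positivity),
      Real.logb_div hq0.ne' (by positivity), Real.logb_pow]
    norm_num
  have hlogm : Real.logb 2 m = 1 / (1 - α) * (1 + Real.logb 2 x - Real.logb 2 T) := by
    rw [hm, Real.logb_rpow_eq_mul_logb_of_pos (by positivity),
      Real.logb_div (by positivity) hT0.ne', Real.logb_mul (by norm_num) hx0.ne',
      Real.logb_self_eq_one (by norm_num)]
  rw [Real.logb_mul (by norm_num) (by positivity), Real.logb_div hl0.ne' hm0.ne',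
    Real.logb_self_eq_one (by norm_num), hlogl, hlogm, renyiEntropy, ← hT, corr, ← hx,
    one_div x, Real.logb_inv]
  -- The bit lost in `l/m + 1 ≤ 2 l/m` is repaid by the factor 2 in the discarded mass `2x`, which
  -- contributes `-1/(1-α)`.
  have h1 : 1 ≤ 1 / (1 - α) := (one_le_div hα1').2 (by linarith)
  have e2 : 2 / (β - 1) = 2 * (1 / (β - 1)) := by ring
  rw [e2]
  linarith

end QInfo

end

/-! ### Optimization over `σ`. -/

theorem theorem2 {A B : Type*} [Fintype A] [DecidableEq A] [Fintype B] [DecidableEq B]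
    (ε α β : ℝ) (hε : ε ∈ Set.Ioo (0 : ℝ) 1) (hα : α ∈ Set.Ioo (0 : ℝ) 1) (hβ : 1 < β)
    (ρ : Matrix (A × B) (A × B) ℂ) (hρ : QInfo.IsDensity ρ) :
    QInfo.smoothImax ε ρ ≤
      ((QInfo.renyiEntropy α (QInfo.marginalA ρ) : ℝ) : EReal) - QInfo.condEntropyUp β ρ
        + ((QInfo.corr α β ε : ℝ) : EReal) := by
  rw [QInfo.condEntropyUp, sub_eq_add_neg, neg_neg, add_right_comm, ← EReal.coe_add, add_comm]
  set r : ℝ := QInfo.renyiEntropy α (QInfo.marginalA ρ) + QInfo.corr α β ε with hr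
  -- The finite term `r` moves to the left so that the right side is a bare infimum over `σ`.
  rw [← EReal.sub_le_iff_le_add (Or.inl (EReal.coe_ne_bot r)) (Or.inl (EReal.coe_ne_top r))]
  refine le_iInf₂ fun σ hσ => ?_
  rw [EReal.sub_le_iff_le_add (Or.inl (EReal.coe_ne_bot r)) (Or.inl (EReal.coe_ne_top r)),
    QInfo.sandwichedD]
  split_ifs with hs
  · refine (QInfo.smoothImax_le_of_suppLE hε hα hβ hρ hσ hs).trans (le_of_eq ?_)
    rw [← EReal.coe_add, hr]
    congr 1
    ring
  · rw [EReal.top_add_coe]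
    exact le_top
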